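/- Let $(M,g)$ be a smooth finite-dimensional Riemannian manifold (without boundary), let $a<b$, let $\gamma\colon[a,b]\to M$ be an absolutely continuous curve, and let $\mathrm{D}_t$ be the covariant derivative along $\gamma$ induced by the Levi-Civita connection (for an absolutely continuous vector field $V$ along $\gamma$, $\mathrm{D}_tV$ is defined almost everywhere). A vector field $\zeta$ along $\gamma$ is parallel if it is absolutely continuous and $\mathrm{D}_t\zeta=0$ a.e. For an $L^1$ vector field $\eta$ along $\gamma$, the covariant integral $\int\!\!\!\!\!\int_a^b\eta(t)\,\mathrm{d}t\in T_{\gamma(b)}M$ is $\nu(b)$, where $\nu$ is the unique absolutely continuous vector field along $\gamma$ with $\nu(a)=0$ and $\mathrm{D}_t\nu=\eta$ a.e. A vector field $\eta$ along $\gamma$ is called smooth if its iterated covariant derivatives $\mathrm{D}_t^j\eta$ of all orders $j\ge 0$ exist and are absolutely continuous (equivalently, its components in a parallel frame along $\gamma$ are $C^\infty$; if $\gamma$ is smooth this is the usual notion). Let $k\ge 0$ be an integer and let $\mu$ be a vector field along $\gamma$ of class $L^1$, i.e. measurable with $\int_a^b|\mu(t)|_g\,\mathrm{d}t<\infty$.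 Suppose that $$\int_a^b g\big(\mu(t),\eta(t)\big)\,\mathrm{d}t=0$$ for every smooth vector field $\eta$ along $\gamma$ with compact support in $(a,b)$ such that $$\int\!\!\!\!\!\int_a^b t^\ell\,\eta(t)\,\mathrm{d}t=0\qquad\text{for all }\ell=0,\dots,k.$$ Then there exist $k+1$ parallel vector fields $\zeta_0,\dots,\zeta_k$ along $\gamma$ such that $$\mu(t)=\sum_{\ell=0}^k t^\ell\,\zeta_\ell(t)\qquad\text{for a.e. }t\in(a,b).$$ -/

import Mathlib

open Set MeasureTheory
open scoped Manifold ContDiff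

noncomputable section

namespace AlongCurve

/-- A smooth Riemannian metric on the (boundaryless) smooth manifold `M` modelled on `E`. -/
abbrev SmoothMetric (E : Type*) [NormedAddCommGroup E] [NormedSpace ℝ E]
    (M : Type*) [TopologicalSpace M] [ChartedSpace E M] [IsManifold 𝓘(ℝ, E) ∞ M] :=
  Bundle.ContMDiffRiemannianMetric 𝓘(ℝ, E) ∞ E (fun x : M => TangentSpace 𝓘(ℝ, E) x)

/-- A (set-theoretic) vector field along the curve `γ`: `V t ∈ T_{γ t} M` for all `t`. -/
abbrev VField (E : Type*) [NormedAddCommGroup E] [NormedSpace ℝ E]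
    {M : Type*} [TopologicalSpace M] [ChartedSpace E M] (γ : ℝ → M) :=
  ∀ t : ℝ, TangentSpace 𝓘(ℝ, E) (γ t)

section Coordinates

variable {E : Type*} [NormedAddCommGroup E] [NormedSpace ℝ E]
  {M : Type*} [TopologicalSpace M] [ChartedSpace E M]

/-- The curve `γ` read in the chart `φ_p` around `p`. -/
def chartCurve (p : M) (γ : ℝ → M) (t : ℝ) : E :=
  extChartAt 𝓘(ℝ, E) p (γ t)

/-- The components `dφ_p (V t)` of a field `V` along `γ` in the chart `φ_p` around `p`. -/
def chartField (p : M) (γ : ℝ → M) (V : VField E γ) (t : ℝ) : E :=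
  mfderiv 𝓘(ℝ, E) 𝓘(ℝ, E) (extChartAt 𝓘(ℝ, E) p) (γ t) (V t)

/-- `[c, d]` is a subinterval of `[a, b]` which `γ` maps into the domain of the chart `φ_p`. -/
def IsChartInterval (E : Type*) [NormedAddCommGroup E] [ChartedSpace E M]
    (p : M) (γ : ℝ → M) (a b c d : ℝ) : Prop :=
  a ≤ c ∧ c ≤ d ∧ d ≤ b ∧ ∀ t ∈ Icc c d, γ t ∈ (chartAt E p).source

/-- `γ : [a, b] → M` is absolutely continuous: it is continuous, and it is absolutely
continuous in every chart on every subinterval that it maps into the domain of that chart. -/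
def IsACCurve (E : Type*) [NormedAddCommGroup E] [NormedSpace ℝ E] [ChartedSpace E M]
    (γ : ℝ → M) (a b : ℝ) : Prop :=
  ContinuousOn γ (Icc a b) ∧
    ∀ (p : M) (c d : ℝ), IsChartInterval E p γ a b c d →
      AbsolutelyContinuousOnInterval (chartCurve (E := E) p γ) c d

/-- The field `V` along `γ` is absolutely continuous on `[a, b]` (components in charts). -/
def IsACField (γ : ℝ → M) (a b : ℝ) (V : VField E γ) : Prop :=
  ∀ (p : M) (c d : ℝ), IsChartInterval E p γ a b c d →
    AbsolutelyContinuousOnInterval (chartField p γ V) c d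

/-- The field `V` along `γ` is Lebesgue measurable on `[a, b]` (components in charts). -/
def IsMeasurableField (γ : ℝ → M) (a b : ℝ) (V : VField E γ) : Prop :=
  ∀ (p : M) (c d : ℝ), IsChartInterval E p γ a b c d →
    AEStronglyMeasurable (chartField p γ V) (volume.restrict (Icc c d))

variable [IsManifold 𝓘(ℝ, E) ∞ M]

/-- The metric in the chart `φ_p`: `G_x(u, v) = g(dφ_p⁻¹ u, dφ_p⁻¹ v)` at `φ_p⁻¹ x`. -/
def chartMetric (g : SmoothMetric E M) (p : M) (x u v : E) : ℝ :=
  g.inner ((extChartAt 𝓘(ℝ, E) p).symm x)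
    (mfderiv 𝓘(ℝ, E) 𝓘(ℝ, E) (extChartAt 𝓘(ℝ, E) p).symm x u)
    (mfderiv 𝓘(ℝ, E) 𝓘(ℝ, E) (extChartAt 𝓘(ℝ, E) p).symm x v)

/-- The Christoffel symbols of the first kind of the Levi-Civita connection in the chart `φ_p`,
`[uv, w] = ½ (∂_u G(v, w) + ∂_v G(u, w) - ∂_w G(u, v)) = G(Γ(u, v), w)`. -/
def christoffelFirst (g : SmoothMetric E M) (p : M) (x u v w : E) : ℝ :=
  (fderiv ℝ (fun y => chartMetric g p y v w) x u
    + fderiv ℝ (fun y => chartMetric g p y u w) x v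
    - fderiv ℝ (fun y => chartMetric g p y u v) x w) / 2

/-- `(D_t V)(t) = W t` in the chart `φ_p`: with `x` the curve in the chart,
`W = V' + Γ_x(x', V)`, the Christoffel term being written with its index lowered, that is,
`G_x(W, w) = G_x(V', w) + [x' V, w]` for every `w`. -/
def HasCovDerivInChartAt (g : SmoothMetric E M) (p : M) (γ : ℝ → M) (V W : VField E γ)
    (t : ℝ) : Prop :=
  ∃ x' V' : E, HasDerivAt (chartCurve p γ) x' t ∧ HasDerivAt (chartField p γ V) V' t ∧
    ∀ w : E, chartMetric g p (chartCurve p γ t) (chartField p γ W t) w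
      = chartMetric g p (chartCurve p γ t) V' w
        + christoffelFirst g p (chartCurve p γ t) x' (chartField p γ V t) w

/-- The field `V` is absolutely continuous along `γ` on `[a, b]`, and its covariant derivative
along `γ` is `W` almost everywhere on `[a, b]`. -/
def IsCovDeriv (g : SmoothMetric E M) (γ : ℝ → M) (a b : ℝ) (V W : VField E γ) : Prop :=
  IsACField γ a b V ∧
    ∀ (p : M) (c d : ℝ), IsChartInterval E p γ a b c d →
      ∀ᵐ t ∂(volume.restrict (Icc c d)), HasCovDerivInChartAt g p γ V W t

/-- `ζ` is a parallel field along `γ` on `[a, b]`: `D_t ζ = 0`. -/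
def IsParallel (g : SmoothMetric E M) (γ : ℝ → M) (a b : ℝ) (ζ : VField E γ) : Prop :=
  IsCovDeriv g γ a b ζ (fun _ => 0)

/-- The covariant integral of `η` along `γ` over `[a, b]` exists and equals `w ∈ T_{γ b} M`:
the field `ν` along `γ` with `ν a = 0` and `D_t ν = η` satisfies `ν b = w`. -/
def HasCovIntegral (g : SmoothMetric E M) (γ : ℝ → M) (a b : ℝ) (η : VField E γ)
    (w : TangentSpace 𝓘(ℝ, E) (γ b)) : Prop :=
  ∃ ν : VField E γ, IsCovDeriv g γ a b ν η ∧ ν a = 0 ∧ ν b = w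

/-- `η` is a smooth field along the absolutely continuous curve `γ` on `[a, b]`: its iterated
covariant derivatives `D_t^j η` of all orders exist (and each is absolutely continuous).
Equivalently, its components in a parallel frame along `γ` are `C^∞`. -/
def IsSmoothField (g : SmoothMetric E M) (γ : ℝ → M) (a b : ℝ) (η : VField E γ) : Prop :=
  ∃ D : ℕ → VField E γ, D 0 = η ∧ ∀ j, IsCovDeriv g γ a b (D j) (D (j + 1))

/-- `η` vanishes on `[a, b]` outside a compact subinterval of `(a, b)`. -/
def HasCompactSupportIn (γ : ℝ → M) (a b : ℝ) (η : VField E γ) : Prop :=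
  ∃ c d : ℝ, a < c ∧ d < b ∧ ∀ t ∈ Icc a b, t ∉ Icc c d → η t = 0

/-- `μ` is a field of class `L¹` along `γ` on `[a, b]`: it is measurable and
`∫_a^b |μ|_g dt < ∞`. -/
def IsL1Field (g : SmoothMetric E M) (γ : ℝ → M) (a b : ℝ) (μ : VField E γ) : Prop :=
  IsMeasurableField γ a b μ ∧
    IntegrableOn (fun t => Real.sqrt (g.inner (γ t) (μ t) (μ t))) (Icc a b)

end Coordinates

end AlongCurve

end

/-! A parallel orthonormal frame turns the statement into a scalar one. Let `e i` be such a frame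
along `γ` and put `f i = g(μ, e i)`, which is integrable because `|f i| ≤ |μ|_g`. For a scalar test
function `φ`, the field `φ • e i` has iterated covariant derivatives `φ⁽ʲ⁾ • e i`, and the covariant
integral of `t ^ ℓ • φ • e i` is `(∫ t ^ ℓ φ) • e i b`. So whenever the moments of `φ` up to order
`k` vanish, the hypothesis yields `∫ f i φ = 0`.

The scalar statement, `exists_polynomial_of_orthogonal`, is linear algebra: a functional that
vanishes on the common kernel of finitely many functionals is a linear combination of them. Hence `f
i` minus a polynomial annihilates every test function and is zero a.e. Collecting the coefficients
of `t ^ ℓ` in `μ = ∑ f i • e i` gives constant combinations of the frame, which are parallel.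

Most of the work is the frame itself, since `γ` is only absolutely continuous and may cross many
charts. In one chart, parallel transport is a linear ODE with integrable coefficients
(`exists_linearODE_solution`). The transformation law of the Christoffel symbols makes the covariant
derivative independent of the chart (`HasCovDerivInChartAt.change_chart`), `interval_induction`
passes from small intervals to `[a, b]`, and metric compatibility keeps the frame orthonormal
(`IsParallel.metricForm_eq`). -/

noncomputable section

/-! ### Absolutely continuous functions with values in a finite-dimensional space. -/

namespace AbsolutelyContinuousOnInterval

open Filter Topology

section Metric

variable {X Y : Type*} [PseudoMetricSpace X] [PseudoMetricSpace Y] {a b : ℝ}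

lemma of_dist_le {f : ℝ → X} {g : ℝ → Y} (hg : AbsolutelyContinuousOnInterval g a b)
    (h : ∀ s ∈ uIcc a b, ∀ t ∈ uIcc a b, dist (f s) (f t) ≤ dist (g s) (g t)) :
    AbsolutelyContinuousOnInterval f a b := by
  rw [absolutelyContinuousOnInterval_iff] at hg ⊢
  intro ε hε
  obtain ⟨δ, hδ, H⟩ := hg ε hε
  refine ⟨δ, hδ, fun I hI hlt => lt_of_le_of_lt ?_ (H I hI hlt)⟩
  exact Finset.sum_le_sum fun i hi => h _ (hI.1 i hi).1 _ (hI.1 i hi).2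

lemma congr {f g : ℝ → X} (hg : AbsolutelyContinuousOnInterval g a b)
    (h : ∀ t ∈ uIcc a b, f t = g t) : AbsolutelyContinuousOnInterval f a b :=
  hg.of_dist_le fun s hs t ht => by rw [h s hs, h t ht]

lemma prodMk {f : ℝ → X} {g : ℝ → Y} (hf : AbsolutelyContinuousOnInterval f a b)
    (hg : AbsolutelyContinuousOnInterval g a b) :
    AbsolutelyContinuousOnInterval (fun t => (f t, g t)) a b := by
  apply squeeze_zero (fun t ↦ ?_) (fun t ↦ ?_) (by simpa using Tendsto.add hf hg)
  · exact Finset.sum_nonneg (fun i hi ↦ by positivity)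
  · rw [← Finset.sum_add_distrib]
    refine Finset.sum_le_sum fun i _ => ?_
    rw [Prod.dist_eq]
    exact max_le_add_of_nonneg dist_nonneg dist_nonneg

lemma lipschitzOnWith_comp {K : NNReal} {φ : X → Y} {s : Set X} {f : ℝ → X}
    (hφ : LipschitzOnWith K φ s)
    (hf : AbsolutelyContinuousOnInterval f a b) (hs : ∀ t ∈ uIcc a b, f t ∈ s) :
    AbsolutelyContinuousOnInterval (fun t => φ (f t)) a b := by
  rw [absolutelyContinuousOnInterval_iff] at hf ⊢
  intro ε hε
  obtain ⟨δ, hδ, H⟩ := hf (ε / (K + 1)) (by positivity)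
  refine ⟨δ, hδ, fun I hI hlt => ?_⟩
  have h1 := H I hI hlt
  have h0 : 0 ≤ ∑ i ∈ Finset.range I.1, dist (f (I.2 i).1) (f (I.2 i).2) :=
    Finset.sum_nonneg fun i _ => dist_nonneg
  rw [lt_div_iff₀ (by positivity)] at h1
  calc ∑ i ∈ Finset.range I.1, dist (φ (f (I.2 i).1)) (φ (f (I.2 i).2))
      ≤ ∑ i ∈ Finset.range I.1, K * dist (f (I.2 i).1) (f (I.2 i).2) :=
        Finset.sum_le_sum fun i hi =>
          hφ.dist_le_mul _ (hs _ (hI.1 i hi).1) _ (hs _ (hI.1 i hi).2)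
    _ = K * ∑ i ∈ Finset.range I.1, dist (f (I.2 i).1) (f (I.2 i).2) := by
        rw [Finset.mul_sum]
    _ < ε := by nlinarith

end Metric

variable {E F : Type*} [NormedAddCommGroup E] [NormedSpace ℝ E]
  [NormedAddCommGroup F] [NormedSpace ℝ F] {a b c d : ℝ}

/-- A `C¹` map is locally Lipschitz, hence Lipschitz on the compact image of `f`; no convexity of
`U` is needed. -/
lemma contDiffOn_comp {φ : E → F} {U : Set E} (hU : IsOpen U) (hφ : ContDiffOn ℝ 1 φ U)
    {f : ℝ → E} (hf : AbsolutelyContinuousOnInterval f a b) (hs : ∀ t ∈ uIcc a b, f t ∈ U) :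
    AbsolutelyContinuousOnInterval (fun t => φ (f t)) a b := by
  have hc : IsCompact (f '' uIcc a b) := isCompact_uIcc.image_of_continuousOn hf.continuousOn
  have hl : LocallyLipschitzOn (f '' uIcc a b) φ := by
    rintro _ ⟨t, ht, rfl⟩
    obtain ⟨K, s, hs', hK⟩ :=
      ((hφ _ (hs t ht)).contDiffAt (hU.mem_nhds (hs t ht))).exists_lipschitzOnWith
    exact ⟨K, s, mem_nhdsWithin_of_mem_nhds hs', hK⟩
  obtain ⟨K, hK⟩ := hl.exists_lipschitzOnWith_of_compact hc
  exact lipschitzOnWith_comp hK hf fun t ht => mem_image_of_mem f ht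

lemma contDiff_comp {φ : E → F} (hφ : ContDiff ℝ 1 φ)
    {f : ℝ → E} (hf : AbsolutelyContinuousOnInterval f a b) :
    AbsolutelyContinuousOnInterval (fun t => φ (f t)) a b :=
  contDiffOn_comp isOpen_univ hφ.contDiffOn hf fun _ _ => mem_univ _

/-- Increments of `f` are bounded by those of the scalar primitive of `‖h‖`, which is absolutely
continuous. -/
lemma of_integral [CompleteSpace E] {h f : ℝ → E} (v : E) (hh : IntervalIntegrable h volume a b)
    (hf : ∀ t ∈ uIcc a b, f t = v + ∫ s in a..t, h s) :
    AbsolutelyContinuousOnInterval f a b := by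
  refine (hh.norm.absolutelyContinuousOnInterval_intervalIntegral
    (c := a) left_mem_uIcc).of_dist_le fun s hs t ht => ?_
  have i1 : ∀ t ∈ uIcc a b, IntervalIntegrable h volume a t := fun t ht =>
    hh.mono_set (uIcc_subset_uIcc_left ht)
  rw [hf s hs, hf t ht, dist_add_left, dist_comm, dist_comm (∫ v in a..s, ‖h v‖),
    dist_eq_norm, dist_eq_norm,
    intervalIntegral.integral_interval_sub_left (i1 t ht) (i1 s hs),
    intervalIntegral.integral_interval_sub_left (i1 t ht).norm (i1 s hs).norm, Real.norm_eq_abs]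
  exact intervalIntegral.norm_integral_le_abs_integral_norm

variable [FiniteDimensional ℝ E]

lemma ae_hasDerivAt_deriv {f : ℝ → E} (hf : AbsolutelyContinuousOnInterval f a b) :
    ∀ᵐ t, t ∈ uIcc a b → HasDerivAt f (deriv f t) t := by
  filter_upwards [hf.boundedVariationOn.ae_differentiableAt_of_mem_uIcc] with t ht h
  exact (ht h).hasDerivAt

/-- Reduces to the scalar fundamental theorem of calculus, one coordinate at a time, through a
linear isomorphism with `ℝⁿ`. -/
lemma intervalIntegrable_deriv_and_integral {f : ℝ → E}
    (hf : AbsolutelyContinuousOnInterval f a b) :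
    IntervalIntegrable (deriv f) volume a b ∧ ∫ t in a..b, deriv f t = f b - f a := by
  obtain ⟨e⟩ : Nonempty (E ≃L[ℝ] (Fin (Module.finrank ℝ E) → ℝ)) :=
    ⟨ContinuousLinearEquiv.ofFinrankEq (by simp)⟩
  have key : ∀ i, AbsolutelyContinuousOnInterval (fun t => e (f t) i) a b := fun i =>
    contDiff_comp (φ := fun x => e x i)
      ((contDiff_apply ℝ ℝ i).comp e.contDiff) hf
  have hd : ∀ᵐ t, t ∈ uIcc a b → ∀ i, deriv (fun t => e (f t) i) t = e (deriv f t) i := by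
    filter_upwards [hf.ae_hasDerivAt_deriv] with t ht h i
    have := (e.hasFDerivAt.comp_hasDerivAt t (ht h))
    exact (hasDerivAt_pi.1 this i).deriv
  have hd' : ∀ᵐ t ∂(volume.restrict (uIoc a b)),
      ∀ i, deriv (fun t => e (f t) i) t = e (deriv f t) i := by
    rw [ae_restrict_iff' measurableSet_uIoc]
    filter_upwards [hd] with t ht h using ht (uIoc_subset_uIcc h)
  have hint : IntervalIntegrable (fun t => e (deriv f t)) volume a b := by
    rw [intervalIntegrable_iff]
    refine Integrable.of_eval fun i => ?_
    have := (key i).intervalIntegrable_deriv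
    rw [intervalIntegrable_iff] at this
    refine this.congr ?_
    filter_upwards [hd'] with t ht using ht i
  have hint' : IntervalIntegrable (deriv f) volume a b := by
    rw [intervalIntegrable_iff] at hint ⊢
    have := e.symm.toContinuousLinearMap.integrable_comp hint
    simpa [IntegrableOn] using this
  refine ⟨hint', e.injective ?_⟩
  have h1 : e (∫ t in a..b, deriv f t) = ∫ t in a..b, e (deriv f t) :=
    (e.toContinuousLinearMap.intervalIntegral_comp_comm hint').symm
  rw [h1]
  ext i
  have h2 : (∫ t in a..b, e (deriv f t)) i = ∫ t in a..b, e (deriv f t) i :=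
    ((ContinuousLinearMap.proj (R := ℝ) (φ := fun _ => ℝ) i).intervalIntegral_comp_comm hint).symm
  rw [h2, map_sub, Pi.sub_apply, ← (key i).integral_deriv_eq_sub]
  refine intervalIntegral.integral_congr_ae ?_
  filter_upwards [hd] with t ht h using (ht (uIoc_subset_uIcc h) i).symm

lemma intervalIntegrable_deriv' {f : ℝ → E} (hf : AbsolutelyContinuousOnInterval f a b) :
    IntervalIntegrable (deriv f) volume a b :=
  hf.intervalIntegrable_deriv_and_integral.1

lemma eq_add_integral_deriv {f : ℝ → E} (hf : AbsolutelyContinuousOnInterval f a b) {t : ℝ}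
    (ht : t ∈ uIcc a b) : f t = f a + ∫ s in a..t, deriv f s := by
  rw [(hf.mono (uIcc_subset_uIcc_left ht)).intervalIntegrable_deriv_and_integral.2]
  abel

/-- On both pieces `f` is the primitive of `deriv f`, so it is one primitive over the whole
interval. -/
lemma glue {f : ℝ → E} (hab : a ≤ b) (hbc : b ≤ c) (h1 : AbsolutelyContinuousOnInterval f a b)
    (h2 : AbsolutelyContinuousOnInterval f b c) : AbsolutelyContinuousOnInterval f a c := by
  refine of_integral (f a) (h1.intervalIntegrable_deriv'.trans h2.intervalIntegrable_deriv')
    fun t ht => ?_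
  rw [uIcc_of_le (hab.trans hbc)] at ht
  rcases le_total t b with htb | htb
  · exact h1.eq_add_integral_deriv (by rw [uIcc_of_le hab]; exact ⟨ht.1, htb⟩)
  · have ht2 : t ∈ uIcc b c := by rw [uIcc_of_le hbc]; exact ⟨htb, ht.2⟩
    rw [← intervalIntegral.integral_add_adjacent_intervals h1.intervalIntegrable_deriv'
      (h2.intervalIntegrable_deriv'.mono_set (uIcc_subset_uIcc_left ht2)), ← add_assoc,
      ← h1.eq_add_integral_deriv right_mem_uIcc, ← h2.eq_add_integral_deriv ht2]

end AbsolutelyContinuousOnInterval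

/-! ### Test functions and the scalar du Bois-Reymond lemma. -/

namespace AlongCurve

/-- The smooth functions with compact support in the open interval `(a, b)`. -/
def testFunctions (a b : ℝ) : Submodule ℝ (ℝ → ℝ) where
  carrier := {φ | ContDiff ℝ ∞ φ ∧ HasCompactSupport φ ∧ tsupport φ ⊆ Ioo a b}
  add_mem' := fun {φ ψ} hφ hψ => ⟨hφ.1.add hψ.1, hφ.2.1.add hψ.2.1,
    (tsupport_add φ ψ).trans (union_subset hφ.2.2 hψ.2.2)⟩
  zero_mem' := ⟨contDiff_const, HasCompactSupport.zero, by simp [tsupport]⟩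
  smul_mem' := fun c φ hφ => ⟨contDiff_const.smul hφ.1, hφ.2.1.smul_left (f := fun _ => c),
    (tsupport_smul_subset_right (fun _ => c) φ).trans hφ.2.2⟩

lemma integrable_mul_testFunction {a b : ℝ} {f : ℝ → ℝ} (hf : IntervalIntegrable f volume a b)
    (φ : testFunctions a b) : IntervalIntegrable (fun t => f t * φ.1 t) volume a b :=
  hf.mul_continuousOn φ.2.1.continuous.continuousOn

/-- The functional `φ ↦ ∫ f φ` on test functions. -/
def pairing (a b : ℝ) (f : ℝ → ℝ) (hf : IntervalIntegrable f volume a b) :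
    testFunctions a b →ₗ[ℝ] ℝ where
  toFun φ := ∫ t in a..b, f t * φ.1 t
  map_add' φ ψ := by
    rw [← intervalIntegral.integral_add (integrable_mul_testFunction hf φ)
      (integrable_mul_testFunction hf ψ)]
    simp [mul_add]
  map_smul' c φ := by
    rw [RingHom.id_apply, smul_eq_mul, ← intervalIntegral.integral_const_mul]
    congr 1; ext t
    simp only [Submodule.coe_smul, Pi.smul_apply, smul_eq_mul]
    ring

lemma ae_eq_zero_of_pairing_eq_zero {a b : ℝ} (hab : a < b) {f : ℝ → ℝ}
    (hf : IntervalIntegrable f volume a b)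
    (h : ∀ φ : testFunctions a b, ∫ t in a..b, f t * φ.1 t = 0) :
    ∀ᵐ t, t ∈ Ioo a b → f t = 0 := by
  have hf' : IntegrableOn f (Ioo a b) :=
    ((intervalIntegrable_iff_integrableOn_Ioc_of_le hab.le).1 hf).mono_set Ioo_subset_Ioc_self
  refine isOpen_Ioo.ae_eq_zero_of_integral_contDiff_smul_eq_zero hf'.locallyIntegrableOn ?_
  intro φ h1 h2 h3
  have := h ⟨φ, h1, h2, h3⟩
  rw [intervalIntegral.integral_of_le hab.le] at this
  rw [← setIntegral_eq_integral_of_forall_compl_eq_zero (s := Ioc a b), ← this]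
  · congr 1; ext t; simp [mul_comm]
  · intro t ht
    have : φ t = 0 := image_eq_zero_of_notMem_tsupport fun h' => ht (Ioo_subset_Ioc_self (h3 h'))
    simp [this]

/-- An integrable function which is orthogonal to all test functions with vanishing moments of
order at most `k` is a polynomial of degree at most `k`. -/
theorem exists_polynomial_of_orthogonal {a b : ℝ} (hab : a < b) (k : ℕ) {f : ℝ → ℝ}
    (hf : IntervalIntegrable f volume a b)
    (h : ∀ φ : testFunctions a b, (∀ l : ℕ, l ≤ k → ∫ t in a..b, t ^ l * φ.1 t = 0) →
      ∫ t in a..b, f t * φ.1 t = 0) :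
    ∃ c : ℕ → ℝ, ∀ᵐ t, t ∈ Ioo a b → f t = ∑ l ∈ Finset.range (k + 1), c l * t ^ l := by
  have hp : ∀ l : ℕ, IntervalIntegrable (fun t : ℝ => t ^ l) volume a b := fun l =>
    (continuous_pow l).intervalIntegrable a b
  -- Vanishing on the common kernel of the `k + 1` moment functionals puts `pairing f` in their
  -- span.
  have hK : pairing a b f hf ∈
      Submodule.span ℝ (range fun l : Fin (k + 1) => pairing a b _ (hp l)) := by
    refine mem_span_of_iInf_ker_le_ker fun φ hφ => ?_
    simp only [Submodule.mem_iInf, LinearMap.mem_ker] at hφ ⊢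
    exact h φ fun l hl => hφ ⟨l, Nat.lt_succ_of_le hl⟩
  obtain ⟨c, hc⟩ := (Submodule.mem_span_range_iff_exists_fun ℝ).1 hK
  -- The value `0` beyond `k` only makes the coefficients total; the sum never reaches it.
  refine ⟨fun l => if hl : l < k + 1 then c ⟨l, hl⟩ else 0, ?_⟩
  set c' : ℕ → ℝ := fun l => if hl : l < k + 1 then c ⟨l, hl⟩ else 0 with hc'
  have hsum : IntervalIntegrable (fun t => ∑ l ∈ Finset.range (k + 1), c' l * t ^ l) volume a b :=
    Continuous.intervalIntegrable (by fun_prop) a b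
  have := ae_eq_zero_of_pairing_eq_zero hab (hf.sub hsum) fun φ => by
    have h1 : ∫ t in a..b, f t * φ.1 t
        = ∑ l : Fin (k + 1), c l * ∫ t in a..b, t ^ (l : ℕ) * φ.1 t := by
      have := LinearMap.congr_fun hc φ
      simp only [LinearMap.coe_sum, Finset.sum_apply, LinearMap.smul_apply, smul_eq_mul] at this
      exact this.symm
    have h2 : ∫ t in a..b, (∑ l ∈ Finset.range (k + 1), c' l * t ^ l) * φ.1 t
        = ∑ l : Fin (k + 1), c l * ∫ t in a..b, t ^ (l : ℕ) * φ.1 t := by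
      simp_rw [Finset.sum_mul, mul_assoc]
      rw [intervalIntegral.integral_finsetSum]
      · rw [Finset.sum_range]
        refine Finset.sum_congr rfl fun l _ => ?_
        rw [intervalIntegral.integral_const_mul]
        rw [show c' l = c l from dif_pos l.2]
      · exact fun l _ => (integrable_mul_testFunction (hp l) φ).const_mul _
    simp_rw [sub_mul]
    rw [intervalIntegral.integral_sub (integrable_mul_testFunction hf φ)
      (integrable_mul_testFunction hsum φ), h1, h2, sub_self]
  filter_upwards [this] with t ht hm using sub_eq_zero.1 (ht hm)

/-! ### The metric and the Christoffel symbols in one chart. -/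

section ChartGeometry

variable {E : Type*} [NormedAddCommGroup E] [NormedSpace ℝ E]
  {M : Type*} [TopologicalSpace M] [ChartedSpace E M]

/-- The derivative of the chart around `p` at the point `q`, as a map of the model space. -/
def dchart (p q : M) : E →L[ℝ] E :=
  mfderiv 𝓘(ℝ, E) 𝓘(ℝ, E) (extChartAt 𝓘(ℝ, E) p) q

/-- The derivative of the inverse of the chart around `p`, as a map of the model space. -/
def dchartSymm (p : M) (y : E) : E →L[ℝ] E :=
  mfderiv 𝓘(ℝ, E) 𝓘(ℝ, E) (extChartAt 𝓘(ℝ, E) p).symm y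

lemma mem_extChartAt_source_iff {p q : M} :
    q ∈ (extChartAt 𝓘(ℝ, E) p).source ↔ q ∈ (chartAt E p).source := by
  rw [extChartAt_source]

lemma isOpen_target (p : M) : IsOpen (extChartAt 𝓘(ℝ, E) p).target :=
  isOpen_extChartAt_target p

variable [IsManifold 𝓘(ℝ, E) ∞ M]

instance : IsManifold 𝓘(ℝ, E) 1 M := IsManifold.of_le (n := ∞) (by simp)

lemma dchart_dchartSymm {p : M} {y : E} (hy : y ∈ (extChartAt 𝓘(ℝ, E) p).target) (v : E) :
    dchart p ((extChartAt 𝓘(ℝ, E) p).symm y) (dchartSymm p y v) = v := by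
  have := mfderiv_extChartAt_comp_mfderivWithin_extChartAt_symm hy
  rw [ModelWithCorners.range_eq_univ, mfderivWithin_univ] at this
  exact DFunLike.congr_fun this v

lemma dchartSymm_dchart' {p : M} {y : E} (hy : y ∈ (extChartAt 𝓘(ℝ, E) p).target) (v : E) :
    dchartSymm p y (dchart p ((extChartAt 𝓘(ℝ, E) p).symm y) v) = v := by
  have := mfderivWithin_extChartAt_symm_comp_mfderiv_extChartAt hy
  rw [ModelWithCorners.range_eq_univ, mfderivWithin_univ] at this
  exact DFunLike.congr_fun this v

lemma dchartSymm_dchart {p q : M} (hq : q ∈ (chartAt E p).source) (v : E) :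
    dchartSymm p (extChartAt 𝓘(ℝ, E) p q) (dchart p q v) = v := by
  rw [← mem_extChartAt_source_iff] at hq
  have := dchartSymm_dchart' ((extChartAt 𝓘(ℝ, E) p).map_source hq) v
  rwa [(extChartAt 𝓘(ℝ, E) p).left_inv hq] at this

lemma dchart_dchartSymm' {p q : M} (hq : q ∈ (chartAt E p).source) (v : E) :
    dchart p q (dchartSymm p (extChartAt 𝓘(ℝ, E) p q) v) = v := by
  rw [← mem_extChartAt_source_iff] at hq
  have := dchart_dchartSymm ((extChartAt 𝓘(ℝ, E) p).map_source hq) v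
  rwa [(extChartAt 𝓘(ℝ, E) p).left_inv hq] at this

/-- The metric at `q` as a bilinear form on the model space. -/
def metricForm (g : SmoothMetric E M) (q : M) : E →L[ℝ] E →L[ℝ] ℝ := g.inner q

lemma metricForm_symm (g : SmoothMetric E M) (q : M) (u v : E) :
    metricForm g q u v = metricForm g q v u := g.symm q u v

lemma metricForm_pos (g : SmoothMetric E M) (q : M) {v : E} (hv : v ≠ 0) :
    0 < metricForm g q v v := g.pos q v hv

/-- The metric read in the chart around `p`, as a field of bilinear forms. -/
def chartForm (g : SmoothMetric E M) (p : M) (y : E) : E →L[ℝ] E →L[ℝ] ℝ :=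
  (metricForm g ((extChartAt 𝓘(ℝ, E) p).symm y)).bilinearComp (dchartSymm p y) (dchartSymm p y)

lemma chartMetric_eq (g : SmoothMetric E M) (p : M) (y u v : E) :
    chartMetric g p y u v = chartForm g p y u v := rfl

lemma chartForm_apply (g : SmoothMetric E M) (p : M) (y u v : E) :
    chartForm g p y u v = metricForm g ((extChartAt 𝓘(ℝ, E) p).symm y)
      (dchartSymm p y u) (dchartSymm p y v) := rfl

lemma chartForm_symm (g : SmoothMetric E M) (p : M) (y u v : E) :
    chartForm g p y u v = chartForm g p y v u := metricForm_symm _ _ _ _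

lemma chartForm_pos (g : SmoothMetric E M) {p : M} {y : E}
    (hy : y ∈ (extChartAt 𝓘(ℝ, E) p).target) {v : E} (hv : v ≠ 0) : 0 < chartForm g p y v v := by
  refine metricForm_pos g _ (v := dchartSymm p y v) fun h => hv ?_
  rw [← dchart_dchartSymm hy v]
  exact (congrArg _ h).trans (map_zero _)

lemma chartForm_dchart (g : SmoothMetric E M) {p q : M} (hq : q ∈ (chartAt E p).source) (u v : E) :
    chartForm g p (extChartAt 𝓘(ℝ, E) p q) (dchart p q u) (dchart p q v) = metricForm g q u v := by
  rw [chartForm_apply, dchartSymm_dchart hq, dchartSymm_dchart hq,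
    (extChartAt 𝓘(ℝ, E) p).left_inv (mem_extChartAt_source_iff.2 hq)]

/-- In the trivialization at `p`, whose fibre maps are the derivatives of the chart, this coordinate
field is the constant `v`. Evaluating `g` on two such fields gives the smoothness of `chartForm`. -/
lemma contMDiffAt_dchartSymm {p : M} {y : E} (hy : y ∈ (extChartAt 𝓘(ℝ, E) p).target) (v : E) :
    ContMDiffAt 𝓘(ℝ, E) (𝓘(ℝ, E).prod 𝓘(ℝ, E)) ∞
      (fun z => Bundle.TotalSpace.mk' E (E := fun x : M => TangentSpace 𝓘(ℝ, E) x)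
        ((extChartAt 𝓘(ℝ, E) p).symm z) (dchartSymm p z v)) y := by
  have hsrc : ∀ z ∈ (extChartAt 𝓘(ℝ, E) p).target,
      (extChartAt 𝓘(ℝ, E) p).symm z ∈ (chartAt E p).source := fun z hz =>
    mem_extChartAt_source_iff.1 ((extChartAt 𝓘(ℝ, E) p).map_target hz)
  rw [(trivializationAt E (TangentSpace 𝓘(ℝ, E)) p).contMDiffAt_iff]
  · refine ⟨(contMDiffOn_extChartAt_symm p).contMDiffAt ((isOpen_target p).mem_nhds hy), ?_⟩
    refine (contMDiffAt_const (c := v)).congr_of_eventuallyEq ?_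
    filter_upwards [(isOpen_target p).mem_nhds hy] with z hz
    have h1 := TangentBundle.continuousLinearMapAt_trivializationAt (I := 𝓘(ℝ, E)) (hsrc z hz)
    let w : TangentSpace 𝓘(ℝ, E) ((extChartAt 𝓘(ℝ, E) p).symm z) := dchartSymm p z v
    have h2 := DFunLike.congr_fun h1 w
    rw [Bundle.Trivialization.continuousLinearMapAt_apply,
      Bundle.Trivialization.linearMapAt_apply, if_pos (by simpa using hsrc z hz)] at h2
    exact h2.trans (dchart_dchartSymm hz v)
  · rw [Bundle.Trivialization.mem_source]
    simpa using hsrc y hy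

variable [FiniteDimensional ℝ E]

lemma contDiffOn_chartForm (g : SmoothMetric E M) (p : M) :
    ContDiffOn ℝ ∞ (chartForm g p) (extChartAt 𝓘(ℝ, E) p).target := by
  refine contDiffOn_clm_apply.2 fun u => contDiffOn_clm_apply.2 fun v => ?_
  intro y hy
  refine ContDiffAt.contDiffWithinAt ?_
  rw [← contMDiffAt_iff_contDiffAt]
  have hb : ContMDiffAt 𝓘(ℝ, E) 𝓘(ℝ, E) ∞ (extChartAt 𝓘(ℝ, E) p).symm y :=
    (contMDiffOn_extChartAt_symm p).contMDiffAt ((isOpen_target p).mem_nhds hy)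
  have := ContMDiffAt.clm_bundle_apply₂ (n := ∞) (F₁ := E) (F₂ := E) (F₃ := ℝ)
    (E₃ := Bundle.Trivial M ℝ)
    (g.contMDiff.contMDiffAt.comp y hb) (contMDiffAt_dchartSymm hy u) (contMDiffAt_dchartSymm hy v)
  rw [Bundle.contMDiffAt_totalSpace] at this
  exact this.2

lemma contDiffAt_chartForm (g : SmoothMetric E M) {p : M} {y : E}
    (hy : y ∈ (extChartAt 𝓘(ℝ, E) p).target) : ContDiffAt ℝ ∞ (chartForm g p) y :=
  (contDiffOn_chartForm g p).contDiffAt ((isOpen_target p).mem_nhds hy)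

lemma differentiableAt_chartForm (g : SmoothMetric E M) {p : M} {y : E}
    (hy : y ∈ (extChartAt 𝓘(ℝ, E) p).target) : DifferentiableAt ℝ (chartForm g p) y :=
  (contDiffAt_chartForm g hy).differentiableAt (by simp)

lemma fderiv_chartMetric (g : SmoothMetric E M) {p : M} {y : E}
    (hy : y ∈ (extChartAt 𝓘(ℝ, E) p).target) (u v w : E) :
    fderiv ℝ (fun z => chartMetric g p z u v) y w = fderiv ℝ (chartForm g p) y w u v := by
  have h := (differentiableAt_chartForm g hy).hasFDerivAt
  have h1 := (h.clm_apply (hasFDerivAt_const u y)).clm_apply (hasFDerivAt_const v y)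
  rw [show (fun z => chartMetric g p z u v) = fun z => chartForm g p z u v from rfl, h1.fderiv]
  simp

lemma christoffelFirst_eq (g : SmoothMetric E M) {p : M} {y : E}
    (hy : y ∈ (extChartAt 𝓘(ℝ, E) p).target) (u v w : E) :
    christoffelFirst g p y u v w = (fderiv ℝ (chartForm g p) y u v w
      + fderiv ℝ (chartForm g p) y v u w - fderiv ℝ (chartForm g p) y w u v) / 2 := by
  simp only [christoffelFirst, fderiv_chartMetric g hy]

lemma fderiv_chartForm_symm (g : SmoothMetric E M) {p : M} {y : E}
    (hy : y ∈ (extChartAt 𝓘(ℝ, E) p).target) (u v w : E) :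
    fderiv ℝ (chartForm g p) y w u v = fderiv ℝ (chartForm g p) y w v u := by
  rw [← fderiv_chartMetric g hy, ← fderiv_chartMetric g hy]
  congr 2; ext z
  exact chartForm_symm g p z u v

end ChartGeometry

/-! ### Independence of the covariant derivative from the chart. -/

section ChartChange

open Filter Topology

variable {E : Type*} [NormedAddCommGroup E] [NormedSpace ℝ E]
  {M : Type*} [TopologicalSpace M] [ChartedSpace E M]

/-- The transition map from the chart around `o` to the chart around `p`. -/
def transition (o p : M) (y : E) : E :=
  extChartAt 𝓘(ℝ, E) p ((extChartAt 𝓘(ℝ, E) o).symm y)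

/-- The domain of the transition map from the chart around `o` to the chart around `p`. -/
def transitionDomain (E : Type*) [NormedAddCommGroup E] [NormedSpace ℝ E] [ChartedSpace E M]
    (o p : M) : Set E :=
  (extChartAt 𝓘(ℝ, E) o).target ∩ (extChartAt 𝓘(ℝ, E) o).symm ⁻¹' (chartAt E p).source

lemma isOpen_transitionDomain (o p : M) : IsOpen (transitionDomain E o p) :=
  (continuousOn_extChartAt_symm o).isOpen_inter_preimage (isOpen_target o)
    (chartAt E p).open_source

lemma extChartAt_mem_transitionDomain {o p q : M} (ho : q ∈ (chartAt E o).source)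
    (hp : q ∈ (chartAt E p).source) : extChartAt 𝓘(ℝ, E) o q ∈ transitionDomain E o p := by
  rw [← mem_extChartAt_source_iff] at ho
  refine ⟨(extChartAt 𝓘(ℝ, E) o).map_source ho, ?_⟩
  rwa [mem_preimage, (extChartAt 𝓘(ℝ, E) o).left_inv ho]

lemma transition_extChartAt {o q : M} (p : M) (ho : q ∈ (chartAt E o).source) :
    transition o p (extChartAt 𝓘(ℝ, E) o q) = extChartAt 𝓘(ℝ, E) p q := by
  rw [transition, (extChartAt 𝓘(ℝ, E) o).left_inv (mem_extChartAt_source_iff.2 ho)]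

lemma transition_mem_target {o p : M} {y : E} (hy : y ∈ transitionDomain E o p) :
    transition o p y ∈ (extChartAt 𝓘(ℝ, E) p).target :=
  (extChartAt 𝓘(ℝ, E) p).map_source (mem_extChartAt_source_iff.2 hy.2)

variable [IsManifold 𝓘(ℝ, E) ∞ M]

lemma contDiffAt_transition {o p : M} {y : E} (hy : y ∈ transitionDomain E o p) :
    ContDiffAt ℝ ∞ (transition o p) y := by
  rw [← contMDiffAt_iff_contDiffAt]
  exact (contMDiffAt_extChartAt' hy.2).comp y
    ((contMDiffOn_extChartAt_symm o).contMDiffAt ((isOpen_target o).mem_nhds hy.1))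

lemma fderiv_transition {o p : M} {y : E} (hy : y ∈ transitionDomain E o p) (v : E) :
    fderiv ℝ (transition o p) y v
      = dchart p ((extChartAt 𝓘(ℝ, E) o).symm y) (dchartSymm o y v) := by
  have h1 : MDifferentiableAt 𝓘(ℝ, E) 𝓘(ℝ, E) (extChartAt 𝓘(ℝ, E) p)
      ((extChartAt 𝓘(ℝ, E) o).symm y) := mdifferentiableAt_extChartAt hy.2
  have h2 : MDifferentiableAt 𝓘(ℝ, E) 𝓘(ℝ, E) (extChartAt 𝓘(ℝ, E) o).symm y :=
    (mdifferentiableOn_extChartAt_symm y hy.1).mdifferentiableAt ((isOpen_target o).mem_nhds hy.1)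
  have h3 := mfderiv_comp y h1 h2
  have h4 : mfderiv 𝓘(ℝ, E) 𝓘(ℝ, E)
      (extChartAt 𝓘(ℝ, E) p ∘ (extChartAt 𝓘(ℝ, E) o).symm) y = fderiv ℝ (transition o p) y :=
    mfderiv_eq_fderiv
  exact DFunLike.congr_fun (h4.symm.trans h3) v

lemma dchart_eq_fderiv_transition {o p q : M} (ho : q ∈ (chartAt E o).source)
    (hp : q ∈ (chartAt E p).source) (v : E) :
    dchart p q v = fderiv ℝ (transition o p) (extChartAt 𝓘(ℝ, E) o q) (dchart o q v) := by
  rw [fderiv_transition (extChartAt_mem_transitionDomain ho hp), dchartSymm_dchart ho,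
    (extChartAt 𝓘(ℝ, E) o).left_inv (mem_extChartAt_source_iff.2 ho)]

lemma chartForm_transition (g : SmoothMetric E M) {o p : M} {y : E}
    (hy : y ∈ transitionDomain E o p) (u v : E) :
    chartForm g o y u v = chartForm g p (transition o p y)
      (fderiv ℝ (transition o p) y u) (fderiv ℝ (transition o p) y v) := by
  rw [fderiv_transition hy, fderiv_transition hy, transition, chartForm_dchart g hy.2,
    chartForm_apply]

lemma chartField_eq_fderiv_transition {o p : M} {γ : ℝ → M} (V : VField E γ) {t : ℝ}
    (ho : γ t ∈ (chartAt E o).source) (hp : γ t ∈ (chartAt E p).source) :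
    chartField p γ V t
      = fderiv ℝ (transition o p) (chartCurve o γ t) (chartField o γ V t) :=
  dchart_eq_fderiv_transition ho hp (V t)

lemma fderiv_fderiv_transition_symm {o p : M} {y : E} (hy : y ∈ transitionDomain E o p)
    (u v : E) : fderiv ℝ (fderiv ℝ (transition o p)) y u v
      = fderiv ℝ (fderiv ℝ (transition o p)) y v u :=
  ((contDiffAt_transition hy).isSymmSndFDerivAt (by simpa using by norm_cast)) u v

variable [FiniteDimensional ℝ E]

/-- Product and chain rule applied to `chartForm_transition`, which holds on a neighbourhood of `y`.
-/
lemma fderiv_chartForm_transition (g : SmoothMetric E M) {o p : M} {y : E}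
    (hy : y ∈ transitionDomain E o p) (u v w : E) :
    fderiv ℝ (chartForm g o) y w u v =
      fderiv ℝ (chartForm g p) (transition o p y) (fderiv ℝ (transition o p) y w)
        (fderiv ℝ (transition o p) y u) (fderiv ℝ (transition o p) y v)
      + chartForm g p (transition o p y) (fderiv ℝ (fderiv ℝ (transition o p)) y w u)
        (fderiv ℝ (transition o p) y v)
      + chartForm g p (transition o p y) (fderiv ℝ (transition o p) y u)
        (fderiv ℝ (fderiv ℝ (transition o p)) y w v) := by
  have hτ := contDiffAt_transition hy
  have h1 : HasFDerivAt (transition o p) (fderiv ℝ (transition o p) y) y :=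
    (hτ.differentiableAt (by simp)).hasFDerivAt
  have h2 : HasFDerivAt (fderiv ℝ (transition o p)) (fderiv ℝ (fderiv ℝ (transition o p)) y) y :=
    ((hτ.fderiv_right (m := 1) (by norm_cast)).differentiableAt (by simp)).hasFDerivAt
  have h3 := HasFDerivAt.comp (g := chartForm g p) y
    (differentiableAt_chartForm g (transition_mem_target hy)).hasFDerivAt h1
  have h4 := ((h3.clm_apply (h2.clm_apply (hasFDerivAt_const u y))).clm_apply
    (h2.clm_apply (hasFDerivAt_const v y)))
  have h5 : (fun z => chartMetric g o z u v) =ᶠ[𝓝 y] fun z =>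
      (chartForm g p ∘ transition o p) z (fderiv ℝ (transition o p) z u)
        (fderiv ℝ (transition o p) z v) := by
    filter_upwards [(isOpen_transitionDomain o p).mem_nhds hy] with z hz
    exact chartForm_transition g hz u v
  rw [← fderiv_chartMetric g hy.1, h5.fderiv_eq, h4.fderiv]
  simp
  abel

/-- Of the six terms containing a second derivative of the transition map, symmetry of that
derivative cancels four and makes the other two equal; the factor `1/2` leaves one inhomogeneous
term. -/
lemma christoffelFirst_transition (g : SmoothMetric E M) {o p : M} {y : E}
    (hy : y ∈ transitionDomain E o p) (u v w : E) :
    christoffelFirst g o y u v w = christoffelFirst g p (transition o p y)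
        (fderiv ℝ (transition o p) y u) (fderiv ℝ (transition o p) y v)
        (fderiv ℝ (transition o p) y w)
      + chartForm g p (transition o p y) (fderiv ℝ (fderiv ℝ (transition o p)) y u v)
        (fderiv ℝ (transition o p) y w) := by
  rw [christoffelFirst_eq g hy.1, christoffelFirst_eq g (transition_mem_target hy),
    fderiv_chartForm_transition g hy, fderiv_chartForm_transition g hy,
    fderiv_chartForm_transition g hy, fderiv_fderiv_transition_symm hy v u,
    fderiv_fderiv_transition_symm hy w u, fderiv_fderiv_transition_symm hy w v,
    chartForm_symm g p _ (fderiv ℝ (transition o p) y v),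
    chartForm_symm g p _ (fderiv ℝ (transition o p) y u)
      (fderiv ℝ (fderiv ℝ (transition o p)) y v w)]
  ring

lemma HasCovDerivInChartAt.change_chart {g : SmoothMetric E M} {o p : M} {γ : ℝ → M}
    {V W : VField E γ} {t : ℝ} (h : HasCovDerivInChartAt g o γ V W t)
    (hγ : ∀ᶠ s in 𝓝 t, γ s ∈ (chartAt E o).source ∧ γ s ∈ (chartAt E p).source) :
    HasCovDerivInChartAt g p γ V W t := by
  obtain ⟨x', V', hx, hV, H⟩ := h
  obtain ⟨ho, hp⟩ := hγ.self_of_nhds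
  have hy : chartCurve o γ t ∈ transitionDomain E o p := extChartAt_mem_transitionDomain ho hp
  have hτ := contDiffAt_transition hy
  have h1 : HasFDerivAt (transition o p) (fderiv ℝ (transition o p) (chartCurve o γ t))
      (chartCurve o γ t) := (hτ.differentiableAt (by simp)).hasFDerivAt
  have h2 : HasFDerivAt (fderiv ℝ (transition o p))
      (fderiv ℝ (fderiv ℝ (transition o p)) (chartCurve o γ t)) (chartCurve o γ t) :=
    ((hτ.fderiv_right (m := 1) (by norm_cast)).differentiableAt (by simp)).hasFDerivAt
  have hc : ∀ s, γ s ∈ (chartAt E o).source → chartCurve p γ s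
      = transition o p (chartCurve o γ s) := fun s hs => (transition_extChartAt p hs).symm
  -- The second-derivative term in the new `V'` is exactly the inhomogeneous term of the Christoffel
  -- symbols.
  refine ⟨fderiv ℝ (transition o p) (chartCurve o γ t) x',
    fderiv ℝ (fderiv ℝ (transition o p)) (chartCurve o γ t) x' (chartField o γ V t)
      + fderiv ℝ (transition o p) (chartCurve o γ t) V', ?_, ?_, fun w => ?_⟩
  · refine (h1.comp_hasDerivAt t hx).congr_of_eventuallyEq ?_
    filter_upwards [hγ] with s hs using hc s hs.1
  · refine ((h2.comp_hasDerivAt t hx).clm_apply hV).congr_of_eventuallyEq ?_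
    filter_upwards [hγ] with s hs using chartField_eq_fderiv_transition V hs.1 hs.2
  -- The derivative of the transition map is onto, so it suffices to test against vectors coming
  -- from the chart at `o`.
  · obtain ⟨w, rfl⟩ : ∃ w₀, fderiv ℝ (transition o p) (chartCurve o γ t) w₀ = w := by
      refine ⟨dchart o (γ t) (dchartSymm p (extChartAt 𝓘(ℝ, E) p (γ t)) w), ?_⟩
      rw [chartCurve, ← dchart_eq_fderiv_transition ho hp, dchart_dchartSymm' hp]
    have := H w
    rw [chartMetric_eq, chartMetric_eq, chartForm_transition g hy, chartForm_transition g hy,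
      christoffelFirst_transition g hy] at this
    rw [hc t ho, chartMetric_eq, chartMetric_eq, chartField_eq_fderiv_transition V ho hp,
      chartField_eq_fderiv_transition W ho hp, this, map_add, add_apply]
    ring

end ChartChange

/-! ### From small intervals to the whole interval. -/

open Filter Topology

/-- A property of intervals which holds for all sufficiently small subintervals of `[a, b]` and is
stable under concatenation holds for `[a, b]`. -/
lemma interval_induction {a b : ℝ} (hab : a ≤ b) {P : ℝ → ℝ → Prop}
    (hloc : ∀ t ∈ Icc a b, ∃ U : Set ℝ, IsOpen U ∧ t ∈ U ∧
      ∀ c d, a ≤ c → c ≤ d → d ≤ b → Icc c d ⊆ U → P c d)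
    (hglue : ∀ c m d, a ≤ c → c ≤ m → m ≤ d → d ≤ b → P c m → P m d → P c d) : P a b := by
  choose! U hU htU hP using hloc
  obtain ⟨t, ht0, hmono, ⟨n, hn⟩, hsub⟩ := exists_monotone_Icc_subset_open_cover_Icc hab
    (c := fun i : Icc a b => (Subtype.val ⁻¹' U i : Set (Icc a b)))
    (fun i => (hU i i.2).preimage continuous_subtype_val)
    (fun x _ => mem_iUnion.2 ⟨x, htU x x.2⟩)
  have hstep : ∀ m, P (t m) (t (m + 1)) := fun m => by
    obtain ⟨i, hi⟩ := hsub m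
    refine hP i i.2 _ _ (t m).2.1 (hmono m.le_succ) (t (m + 1)).2.2 fun s hs => ?_
    exact hi (a := ⟨s, (t m).2.1.trans hs.1, hs.2.trans (t (m + 1)).2.2⟩) hs
  have key : ∀ m, P a (t (m + 1)) := by
    intro m
    induction m with
    | zero => simpa [ht0] using hstep 0
    | succ m ih =>
      exact hglue _ _ _ le_rfl (t (m + 1)).2.1 (hmono (m + 1).le_succ) (t (m + 2)).2.2 ih
        (hstep (m + 1))
  -- The partition points equal `b` from index `n` on, so `t (n + 1) = b`.
  simpa [hn (n + 1) n.le_succ] using key n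

/-! ### Locality and gluing of covariant derivatives. -/

section CovDeriv

variable {E : Type*} [NormedAddCommGroup E]
  {M : Type*} [TopologicalSpace M] [ChartedSpace E M] {γ : ℝ → M} {a b : ℝ}

lemma IsChartInterval.mono {p : M} {a' b' c d : ℝ} (h : IsChartInterval E p γ a' b' c d)
    (ha : a ≤ a') (hb : b' ≤ b) : IsChartInterval E p γ a b c d :=
  ⟨ha.trans h.1, h.2.1, h.2.2.1.trans hb, h.2.2.2⟩

lemma IsChartInterval.sub {p : M} {c d c' d' : ℝ} (h : IsChartInterval E p γ a b c d)
    (hc : c ≤ c') (hcd : c' ≤ d') (hd : d' ≤ d) : IsChartInterval E p γ c' d' c' d' :=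
  ⟨le_rfl, hcd, le_rfl, fun t ht => h.2.2.2 t ⟨hc.trans ht.1, ht.2.trans hd⟩⟩

variable [NormedSpace ℝ E]

lemma chartCurve_mem_target {p : M} {t : ℝ} (h : γ t ∈ (chartAt E p).source) :
    chartCurve p γ t ∈ (extChartAt 𝓘(ℝ, E) p).target :=
  (extChartAt 𝓘(ℝ, E) p).map_source (mem_extChartAt_source_iff.2 h)

lemma chartField_congr {p : M} {V V' : VField E γ} {t : ℝ} (h : V' t = V t) :
    chartField p γ V' t = chartField p γ V t :=
  congrArg (dchart p (γ t)) h

/-- Endpoints are null. At interior points, identities known only on `[c, d]` hold near the point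
and may be differentiated. -/
lemma ae_restrict_Icc_of_Ioo {P : ℝ → Prop} {c d : ℝ}
    (h : ∀ᵐ t ∂(volume.restrict (Icc c d)), t ∈ Ioo c d → P t) :
    ∀ᵐ t ∂(volume.restrict (Icc c d)), P t := by
  rw [← restrict_Ioo_eq_restrict_Icc] at h ⊢
  filter_upwards [h, ae_restrict_mem measurableSet_Ioo] with t h1 h2 using h1 h2

lemma IsACCurve.mono (h : IsACCurve E γ a b) {c d : ℝ} (ha : a ≤ c) (hb : d ≤ b) :
    IsACCurve E γ c d :=
  ⟨h.1.mono (Icc_subset_Icc ha hb), fun p _ _ hI => h.2 p _ _ (hI.mono ha hb)⟩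

/-- Around each parameter, small subintervals are mapped into a single chart. -/
lemma IsACCurve.exists_chart (h : IsACCurve E γ a b) {t : ℝ} (ht : t ∈ Icc a b) :
    ∃ U : Set ℝ, IsOpen U ∧ t ∈ U ∧
      ∀ c d, a ≤ c → c ≤ d → d ≤ b → Icc c d ⊆ U → IsChartInterval E (γ t) γ a b c d := by
  have := h.1 t ht ((chartAt E (γ t)).open_source.mem_nhds (mem_chart_source E (γ t)))
  obtain ⟨U, hU, htU, hsub⟩ := mem_nhdsWithin.1 (mem_map.1 this)
  exact ⟨U, hU, htU, fun c d hc hcd hd hs => ⟨hc, hcd, hd, fun s hs' =>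
    hsub ⟨hs hs', hc.trans hs'.1, hs'.2.trans hd⟩⟩⟩

variable [IsManifold 𝓘(ℝ, E) ∞ M] {g : SmoothMetric E M}

lemma HasCovDerivInChartAt.congr {p : M} {V V' W W' : VField E γ} {t : ℝ}
    (h : HasCovDerivInChartAt g p γ V W t) (hV : ∀ᶠ s in 𝓝 t, V' s = V s) (hW : W' t = W t) :
    HasCovDerivInChartAt g p γ V' W' t := by
  obtain ⟨x', v', hx, hv, H⟩ := h
  refine ⟨x', v', hx, hv.congr_of_eventuallyEq ?_, fun w => ?_⟩
  · filter_upwards [hV] with s hs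
    exact chartField_congr hs
  · rw [chartField_congr hV.self_of_nhds, chartField_congr hW]
    exact H w

lemma IsCovDeriv.congr {V V' W W' : VField E γ} (h : IsCovDeriv g γ a b V W)
    (hV : ∀ t ∈ Icc a b, V' t = V t) (hW : ∀ t ∈ Icc a b, W' t = W t) :
    IsCovDeriv g γ a b V' W' := by
  have hs : ∀ {p c d}, IsChartInterval E p γ a b c d → Icc c d ⊆ Icc a b := fun hI =>
    Icc_subset_Icc hI.1 hI.2.2.1
  refine ⟨fun p c d hI => (h.1 p c d hI).congr fun t ht => ?_, fun p c d hI => ?_⟩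
  · rw [uIcc_of_le hI.2.1] at ht
    exact chartField_congr (hV t (hs hI ht))
  · refine ae_restrict_Icc_of_Ioo ?_
    filter_upwards [h.2 p c d hI] with t ht hm
    refine ht.congr ?_ (hW t (hs hI (Ioo_subset_Icc_self hm)))
    filter_upwards [Icc_mem_nhds hm.1 hm.2] with s hm' using hV s (hs hI hm')

variable [FiniteDimensional ℝ E]

lemma IsCovDeriv.glue {V W : VField E γ} {m : ℝ} (h1 : IsCovDeriv g γ a m V W)
    (h2 : IsCovDeriv g γ m b V W) : IsCovDeriv g γ a b V W := by
  have key : ∀ (p : M) (c d : ℝ), IsChartInterval E p γ a b c d →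
      AbsolutelyContinuousOnInterval (chartField p γ V) c d ∧
      ∀ᵐ t ∂(volume.restrict (Icc c d)), HasCovDerivInChartAt g p γ V W t := by
    intro p c d hI
    obtain ⟨hac, hcd, hdb, hs⟩ := hI
    rcases le_total d m with hd | hd
    · exact ⟨h1.1 p c d ⟨hac, hcd, hd, hs⟩, h1.2 p c d ⟨hac, hcd, hd, hs⟩⟩
    rcases le_total m c with hc | hc
    · exact ⟨h2.1 p c d ⟨hc, hcd, hdb, hs⟩, h2.2 p c d ⟨hc, hcd, hdb, hs⟩⟩
    have i1 : IsChartInterval E p γ a m c m :=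
      ⟨hac, hc, le_rfl, fun t ht => hs t ⟨ht.1, ht.2.trans hd⟩⟩
    have i2 : IsChartInterval E p γ m b m d :=
      ⟨le_rfl, hd, hdb, fun t ht => hs t ⟨hc.trans ht.1, ht.2⟩⟩
    refine ⟨(h1.1 p c m i1).glue hc hd (h2.1 p m d i2), ?_⟩
    rw [← Icc_union_Icc_eq_Icc hc hd, ae_restrict_union_iff]
    exact ⟨h1.2 p c m i1, h2.2 p m d i2⟩
  exact ⟨fun p c d hI => (key p c d hI).1, fun p c d hI => (key p c d hI).2⟩

/-- A covariant derivative can be computed in a single chart. -/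
lemma isCovDeriv_of_chart (hγ : IsACCurve E γ a b) {o : M} (ho : IsChartInterval E o γ a b a b)
    {V W : VField E γ} (hV : AbsolutelyContinuousOnInterval (chartField o γ V) a b)
    (h : ∀ᵐ t ∂(volume.restrict (Icc a b)), HasCovDerivInChartAt g o γ V W t) :
    IsCovDeriv g γ a b V W := by
  refine ⟨fun p c d hI => ?_, fun p c d hI => ?_⟩
  · have hsub : uIcc c d ⊆ uIcc a b := by
      rw [uIcc_of_le hI.2.1, uIcc_of_le ho.2.1]
      exact Icc_subset_Icc hI.1 hI.2.2.1
    have hmem : ∀ t ∈ uIcc c d, γ t ∈ (chartAt E o).source ∧ γ t ∈ (chartAt E p).source := by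
      intro t ht
      refine ⟨ho.2.2.2 t ?_, hI.2.2.2 t ?_⟩
      · rw [← uIcc_of_le ho.2.1]; exact hsub ht
      · rwa [uIcc_of_le hI.2.1] at ht
    have hx := (hγ.2 o a b ho).mono hsub
    -- Components in the chart at `p` are a `C¹` function of the pair (curve, components) in the
    -- chart at `o`, so absolute continuity carries over.
    have hφ : ContDiffOn ℝ 1 (fun z : E × E => fderiv ℝ (transition o p) z.1 z.2)
        (transitionDomain E o p ×ˢ univ) := by
      rintro ⟨y, v⟩ ⟨hy, -⟩
      refine ContDiffAt.contDiffWithinAt ?_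
      have := (contDiffAt_transition hy).fderiv_right (m := 1) (by norm_cast)
      exact (this.comp (y, v) contDiffAt_fst).clm_apply contDiffAt_snd
    refine (AbsolutelyContinuousOnInterval.contDiffOn_comp
      ((isOpen_transitionDomain o p).prod isOpen_univ) hφ (hx.prodMk (hV.mono hsub))
      fun t ht => ⟨?_, mem_univ _⟩).congr fun t ht => ?_
    · exact extChartAt_mem_transitionDomain (hmem t ht).1 (hmem t ht).2
    · exact chartField_eq_fderiv_transition V (hmem t ht).1 (hmem t ht).2
  · have hsub := Icc_subset_Icc hI.1 hI.2.2.1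
    refine ae_restrict_Icc_of_Ioo ?_
    filter_upwards [ae_restrict_of_ae_restrict_of_subset hsub h] with t ht hm
    refine ht.change_chart ?_
    filter_upwards [Icc_mem_nhds hm.1 hm.2] with s hs
    exact ⟨ho.2.2.2 s (hsub hs), hI.2.2.2 s hs⟩

end CovDeriv

/-! ### Linear differential equations with integrable coefficients. -/

section LinearODE

variable {E : Type*} [NormedAddCommGroup E] [NormedSpace ℝ E]

lemma intervalIntegrable_clm_apply {F : Type*} [NormedAddCommGroup F] [NormedSpace ℝ F]
    {a b : ℝ} {A : ℝ → E →L[ℝ] F} {u : ℝ → E}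
    (hA : IntervalIntegrable A volume a b) (hu : ContinuousOn u (uIcc a b)) :
    IntervalIntegrable (fun t => A t (u t)) volume a b := by
  obtain ⟨C, hC⟩ := isCompact_uIcc.exists_bound_of_continuousOn hu
  have hum : AEStronglyMeasurable u (volume.restrict (uIoc a b)) :=
    (hu.mono uIoc_subset_uIcc).aestronglyMeasurable measurableSet_uIoc
  rw [intervalIntegrable_iff] at hA ⊢
  refine (hA.norm.mul_const C).mono'
    ((ContinuousLinearMap.id ℝ (E →L[ℝ] F)).aestronglyMeasurable_comp₂ hA.1 hum) ?_
  filter_upwards [ae_restrict_mem measurableSet_uIoc] with t ht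
  exact ((A t).le_opNorm _).trans
    (mul_le_mul_of_nonneg_left (hC t (uIoc_subset_uIcc ht)) (norm_nonneg _))

variable [CompleteSpace E]

/-- A linear integral equation with small kernel has a solution. -/
lemma exists_integral_eq_of_small {a b : ℝ} (hab : a ≤ b) {A : ℝ → E →L[ℝ] E}
    (hA : IntervalIntegrable A volume a b) (hsmall : ∫ t in a..b, ‖A t‖ < 1) (v : E) :
    ∃ u : ℝ → E, Continuous u ∧ ∀ t ∈ Icc a b, u t = v + ∫ s in a..t, A s (u s) := by
  -- Extension by the endpoint values keeps the functions continuous on all of `ℝ`.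
  let ext : C(Icc a b, E) → ℝ → E := fun u s => u (projIcc a b hab s)
  have hext : ∀ u, Continuous (ext u) := fun u => u.continuous.comp continuous_projIcc
  have hint : ∀ u, IntervalIntegrable (fun s => A s (ext u s)) volume a b := fun u =>
    intervalIntegrable_clm_apply hA (hext u).continuousOn
  have hcont : ∀ u, ContinuousOn (fun t => v + ∫ s in a..t, A s (ext u s)) (Icc a b) := by
    intro u
    refine continuousOn_const.add ?_
    rw [← uIcc_of_le hab]
    exact intervalIntegral.continuousOn_primitive_interval' (hint u) left_mem_uIcc
  let T : C(Icc a b, E) → C(Icc a b, E) := fun u =>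
    ⟨fun t => v + ∫ s in a..t, A s (ext u s), (hcont u).domRestrict⟩
  have h0 : 0 ≤ ∫ t in a..b, ‖A t‖ :=
    intervalIntegral.integral_nonneg hab fun _ _ => norm_nonneg _
  -- The Picard operator contracts the sup distance by the factor `∫ ‖A‖ < 1`.
  have hT : ContractingWith (NNReal.mk (∫ t in a..b, ‖A t‖) h0) T := by
    refine ⟨by exact_mod_cast hsmall, LipschitzWith.of_dist_le_mul fun u w => ?_⟩
    rw [NNReal.coe_mk, ContinuousMap.dist_le (mul_nonneg h0 dist_nonneg)]
    rintro ⟨t, ht⟩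
    have hsub : uIcc a t ⊆ uIcc a b := by
      rw [uIcc_of_le ht.1, uIcc_of_le hab]; exact Icc_subset_Icc_right ht.2
    change dist (v + ∫ s in a..t, A s (ext u s)) (v + ∫ s in a..t, A s (ext w s)) ≤ _
    rw [dist_add_left, dist_eq_norm, ← intervalIntegral.integral_sub
      ((hint u).mono_set hsub) ((hint w).mono_set hsub)]
    calc ‖∫ s in a..t, (A s (ext u s) - A s (ext w s))‖
        ≤ ∫ s in a..t, ‖A s‖ * dist u w := by
          refine intervalIntegral.norm_integral_le_of_norm_le ht.1 ?_
            ((hA.norm.mono_set hsub).mul_const _)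
          refine Eventually.of_forall fun s _ => ?_
          rw [← map_sub]
          refine ((A s).le_opNorm _).trans (mul_le_mul_of_nonneg_left ?_ (norm_nonneg _))
          rw [← dist_eq_norm]
          exact ContinuousMap.dist_apply_le_dist _
      _ = (∫ s in a..t, ‖A s‖) * dist u w := intervalIntegral.integral_mul_const _ _
      _ ≤ (∫ s in a..b, ‖A s‖) * dist u w := by
          refine mul_le_mul_of_nonneg_right ?_ dist_nonneg
          exact intervalIntegral.integral_mono_interval le_rfl ht.1 ht.2
            (Eventually.of_forall fun _ => norm_nonneg _) hA.norm
  refine ⟨ext (hT.fixedPoint T), hext _, fun t ht => ?_⟩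
  have := DFunLike.congr_fun hT.fixedPoint_isFixedPt ⟨t, ht⟩
  simp only [ext, projIcc_of_mem hab ht]
  exact this.symm

variable [FiniteDimensional ℝ E]

/-- Carathéodory's existence theorem for linear equations with integrable coefficients. -/
theorem exists_linearODE_solution {a b : ℝ} (hab : a ≤ b) {A : ℝ → E →L[ℝ] E}
    (hA : IntervalIntegrable A volume a b) (v : E) :
    ∃ u : ℝ → E, u a = v ∧ AbsolutelyContinuousOnInterval u a b ∧
      ∀ᵐ t ∂(volume.restrict (Icc a b)), HasDerivAt u (A t (u t)) t := by
  -- Uniform continuity of the primitive of `‖A‖` gives a `δ` such that `∫ ‖A‖ < 1` on every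
  -- subinterval shorter than `δ`; balls of radius `δ / 2` then serve as the local neighbourhoods.
  have hunif := (hA.norm.absolutelyContinuousOnInterval_intervalIntegral
    (c := a) left_mem_uIcc).uniformContinuousOn
  obtain ⟨δ, hδ, hδ'⟩ := Metric.uniformContinuousOn_iff.1 hunif 1 one_pos
  rw [uIcc_of_le hab] at hδ'
  refine interval_induction (P := fun c d => ∀ v : E, ∃ u : ℝ → E, u c = v ∧
    AbsolutelyContinuousOnInterval u c d ∧
      ∀ᵐ t ∂(volume.restrict (Icc c d)), HasDerivAt u (A t (u t)) t) hab ?_ ?_ v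
  · intro t₀ ht₀
    refine ⟨Metric.ball t₀ (δ / 2), Metric.isOpen_ball, Metric.mem_ball_self (by positivity),
      fun c d hac hcd hdb hsub v => ?_⟩
    have hsubI : uIcc c d ⊆ uIcc a b := by
      rw [uIcc_of_le hcd, uIcc_of_le hab]; exact Icc_subset_Icc hac hdb
    have hAcd := hA.mono_set hsubI
    have hac' : IntervalIntegrable A volume a c := hA.mono_set (by
      rw [uIcc_of_le hac, uIcc_of_le hab]; exact Icc_subset_Icc_right (hcd.trans hdb))
    have hlt : dist d c < δ := by
      have h1 := Metric.mem_ball.1 (hsub (left_mem_Icc.2 hcd))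
      have h2 := Metric.mem_ball.1 (hsub (right_mem_Icc.2 hcd))
      linarith [dist_triangle_right d c t₀]
    have hs := hδ' d ⟨hac.trans hcd, hdb⟩ c ⟨hac, hcd.trans hdb⟩ hlt
    rw [dist_eq_norm, intervalIntegral.integral_interval_sub_left
      (hac'.trans hAcd).norm hac'.norm] at hs
    obtain ⟨u, hu, hu'⟩ := exists_integral_eq_of_small hcd hAcd
      (lt_of_le_of_lt (le_abs_self _) hs) v
    have hint := intervalIntegrable_clm_apply hAcd hu.continuousOn
    refine ⟨u, by simpa using hu' c (left_mem_Icc.2 hcd),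
      AbsolutelyContinuousOnInterval.of_integral v hint fun t ht =>
        hu' t (by rwa [uIcc_of_le hcd] at ht), ?_⟩
    refine ae_restrict_Icc_of_Ioo ?_
    filter_upwards [ae_restrict_of_ae hint.ae_hasDerivAt_integral] with t ht hm
    have h1 := ht (by rw [uIcc_of_le hcd]; exact Ioo_subset_Icc_self hm) c left_mem_uIcc
    refine (h1.const_add v).congr_of_eventuallyEq ?_
    filter_upwards [Icc_mem_nhds hm.1 hm.2] with s hs using hu' s hs
  · intro c m d _ hcm hmd _ h1 h2 v
    obtain ⟨u, hu, hac, hd⟩ := h1 v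
    obtain ⟨w, hw, hac', hd'⟩ := h2 (u m)
    let z : ℝ → E := fun t => if t ≤ m then u t else w t
    have hz1 : ∀ t ≤ m, z t = u t := fun t ht => if_pos ht
    have hz2 : ∀ t, m ≤ t → z t = w t := fun t ht => by
      rcases ht.eq_or_lt with rfl | h
      · rw [hz1 _ le_rfl, hw]
      · exact if_neg h.not_ge
    refine ⟨z, by rw [hz1 c hcm, hu], (hac.congr fun t ht => ?_).glue hcm hmd
      (hac'.congr fun t ht => ?_), ?_⟩
    · rw [uIcc_of_le hcm] at ht; exact hz1 t ht.2
    · rw [uIcc_of_le hmd] at ht; exact hz2 t ht.1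
    rw [← Icc_union_Icc_eq_Icc hcm hmd, ae_restrict_union_iff]
    refine ⟨ae_restrict_Icc_of_Ioo ?_, ae_restrict_Icc_of_Ioo ?_⟩
    · filter_upwards [hd] with t ht hm
      rw [hz1 t hm.2.le]
      refine ht.congr_of_eventuallyEq ?_
      filter_upwards [Iio_mem_nhds hm.2] with s hs using hz1 s (le_of_lt hs)
    · filter_upwards [hd'] with t ht hm
      rw [hz2 t hm.1.le]
      refine ht.congr_of_eventuallyEq ?_
      filter_upwards [Ioi_mem_nhds hm.1] with s hs using hz2 s (le_of_lt hs)

end LinearODE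

set_option maxSynthPendingDepth 3

/-! ### Parallel transport. -/

section ParallelTransport

variable {E : Type*} [NormedAddCommGroup E] [NormedSpace ℝ E] [FiniteDimensional ℝ E]

/-- Definiteness gives injectivity into the dual, which has the same dimension. This allows raising
the index of the Christoffel symbols. -/
lemma isInvertible_of_pos {B : E →L[ℝ] E →L[ℝ] ℝ} (hB : ∀ v, v ≠ 0 → 0 < B v v) :
    B.IsInvertible := by
  let e : (E →ₗ[ℝ] ℝ) ≃ₗ[ℝ] (E →L[ℝ] ℝ) := LinearMap.toContinuousLinearMap
  have hinj : Function.Injective (B : E →ₗ[ℝ] E →L[ℝ] ℝ) := by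
    rw [← LinearMap.ker_eq_bot, LinearMap.ker_eq_bot']
    intro v hv
    by_contra h
    have h0 : B v v = 0 := by
      have : B v = 0 := hv
      simp [this]
    exact (hB v h).ne' h0
  have hfin : FiniteDimensional ℝ (E →L[ℝ] ℝ) := Module.Finite.equiv e
  have hrank : Module.finrank ℝ E = Module.finrank ℝ (E →L[ℝ] ℝ) := by
    rw [← e.finrank_eq]
    exact Subspace.dual_finrank_eq.symm
  exact ⟨((B : E →ₗ[ℝ] E →L[ℝ] ℝ).linearEquivOfInjective hinj hrank).toContinuousLinearEquiv,
    by ext; rfl⟩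

variable {M : Type*} [TopologicalSpace M] [ChartedSpace E M] [IsManifold 𝓘(ℝ, E) ∞ M]

/-- The Christoffel symbols of the first kind as a field of trilinear forms. -/
def christoffelForm (g : SmoothMetric E M) (p : M) (y : E) : E →L[ℝ] E →L[ℝ] E →L[ℝ] ℝ :=
  (2⁻¹ : ℝ) • (fderiv ℝ (chartForm g p) y + (fderiv ℝ (chartForm g p) y).flip
    - ((ContinuousLinearMap.flipₗᵢ ℝ E E ℝ).toContinuousLinearEquiv :
      (E →L[ℝ] E →L[ℝ] ℝ) →L[ℝ] E →L[ℝ] E →L[ℝ] ℝ).comp (fderiv ℝ (chartForm g p) y).flip)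

lemma christoffelForm_apply (g : SmoothMetric E M) {p : M} {y : E}
    (hy : y ∈ (extChartAt 𝓘(ℝ, E) p).target) (u v w : E) :
    christoffelForm g p y u v w = christoffelFirst g p y u v w := by
  rw [christoffelFirst_eq g hy]
  simp [christoffelForm]
  ring

/-- The Christoffel symbols of the second kind as a field of bilinear maps. -/
def christoffelSecond (g : SmoothMetric E M) (p : M) (y : E) : E →L[ℝ] E →L[ℝ] E :=
  (ContinuousLinearMap.compL ℝ E (E →L[ℝ] ℝ) E (chartForm g p y).inverse).comp
    (christoffelForm g p y)

lemma chartForm_christoffelSecond (g : SmoothMetric E M) {p : M} {y : E}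
    (hy : y ∈ (extChartAt 𝓘(ℝ, E) p).target) (u v w : E) :
    chartForm g p y (christoffelSecond g p y u v) w = christoffelFirst g p y u v w := by
  rw [← christoffelForm_apply g hy]
  have h := isInvertible_of_pos fun v hv => chartForm_pos g hy (v := v) hv
  have : chartForm g p y ((chartForm g p y).inverse (christoffelForm g p y u v))
      = christoffelForm g p y u v := h.self_apply_inverse _
  exact DFunLike.congr_fun this w

/-- Inversion is continuous at invertible maps. Along the curve this bounds the symbols, so their
product with the integrable velocity is integrable. -/
lemma continuousOn_christoffelSecond (g : SmoothMetric E M) (p : M) :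
    ContinuousOn (christoffelSecond g p) (extChartAt 𝓘(ℝ, E) p).target := by
  have hD : ContinuousOn (fderiv ℝ (chartForm g p)) (extChartAt 𝓘(ℝ, E) p).target :=
    (contDiffOn_chartForm g p).continuousOn_fderiv_of_isOpen (isOpen_target p) (by simp)
  have hflip : ContinuousOn (fun y => (fderiv ℝ (chartForm g p) y).flip)
      (extChartAt 𝓘(ℝ, E) p).target :=
    (ContinuousLinearMap.flipₗᵢ ℝ E E (E →L[ℝ] ℝ)).continuous.comp_continuousOn hD
  have hC : ContinuousOn (christoffelForm g p) (extChartAt 𝓘(ℝ, E) p).target :=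
    ((hD.add hflip).sub ((continuousOn_const
      (c := ((ContinuousLinearMap.flipₗᵢ ℝ E E ℝ).toContinuousLinearEquiv :
      (E →L[ℝ] E →L[ℝ] ℝ) →L[ℝ] E →L[ℝ] E →L[ℝ] ℝ))).clm_comp hflip)).const_smul (2⁻¹ : ℝ)
  refine ContinuousOn.clm_comp ?_ hC
  refine (ContinuousLinearMap.compL ℝ E (E →L[ℝ] ℝ) E).continuous.comp_continuousOn ?_
  intro y hy
  have h := isInvertible_of_pos fun v hv => chartForm_pos g hy (v := v) hv
  exact ((h.contDiffAt_map_inverse (n := 0)).continuousAt.comp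
    (contDiffAt_chartForm g hy).continuousAt).continuousWithinAt

variable {g : SmoothMetric E M} {γ : ℝ → M} {a b : ℝ}

/-- In the chart, parallelism is the linear equation `u' = -Γ(x', u)`; its solution is pulled back
by the inverse of the chart's derivative. -/
lemma exists_parallel_of_chart (hγ : IsACCurve E γ a b) {o : M}
    (ho : IsChartInterval E o γ a b a b) (v : TangentSpace 𝓘(ℝ, E) (γ a)) :
    ∃ V : VField E γ, V a = v ∧ IsParallel g γ a b V := by
  have hab : a ≤ b := ho.2.1
  have hx := hγ.2 o a b ho
  have hΓ : ContinuousOn (fun t => christoffelSecond g o (chartCurve o γ t)) (uIcc a b) :=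
    (continuousOn_christoffelSecond g o).comp hx.continuousOn fun t ht =>
      chartCurve_mem_target (ho.2.2.2 t (by rwa [uIcc_of_le hab] at ht))
  have hA : IntervalIntegrable
      (fun t => -christoffelSecond g o (chartCurve o γ t) (deriv (chartCurve o γ) t))
      volume a b := by
    refine IntervalIntegrable.neg ?_
    obtain ⟨C, hC⟩ := isCompact_uIcc.exists_bound_of_continuousOn hΓ
    have hx' := hx.intervalIntegrable_deriv'
    rw [intervalIntegrable_iff] at hx' ⊢
    have hΓm : AEStronglyMeasurable (fun t => christoffelSecond g o (chartCurve o γ t))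
        (volume.restrict (uIoc a b)) :=
      (hΓ.mono uIoc_subset_uIcc).aestronglyMeasurable measurableSet_uIoc
    refine (hx'.norm.const_mul C).mono'
      ((ContinuousLinearMap.id ℝ (E →L[ℝ] E →L[ℝ] E)).aestronglyMeasurable_comp₂ hΓm hx'.1) ?_
    filter_upwards [ae_restrict_mem measurableSet_uIoc] with t ht
    exact (ContinuousLinearMap.le_opNorm _ _).trans
      (mul_le_mul_of_nonneg_right (hC t (uIoc_subset_uIcc ht)) (norm_nonneg _))
  obtain ⟨u, hu, hac, hd⟩ := exists_linearODE_solution hab hA (dchart o (γ a) v)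
  let V : VField E γ := fun t => (dchartSymm o (chartCurve o γ t) (u t) : E)
  have hV : ∀ t ∈ Icc a b, chartField o γ V t = u t := fun t ht =>
    dchart_dchartSymm' (ho.2.2.2 t ht) (u t)
  have hVa : V a = v := by
    change dchartSymm o (chartCurve o γ a) (u a) = v
    rw [hu]
    exact dchartSymm_dchart (ho.2.2.2 a (left_mem_Icc.2 hab)) v
  refine ⟨V, hVa, isCovDeriv_of_chart hγ ho (hac.congr fun t ht =>
    hV t (by rwa [uIcc_of_le hab] at ht)) (ae_restrict_Icc_of_Ioo ?_)⟩
  filter_upwards [hd, ae_restrict_of_ae hx.ae_hasDerivAt_deriv] with t ht hxt hm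
  have htI := Ioo_subset_Icc_self hm
  have hmem := chartCurve_mem_target (ho.2.2.2 t htI)
  refine ⟨_, _, hxt (by rwa [uIcc_of_le hab]), ht.congr_of_eventuallyEq ?_, fun w => ?_⟩
  · filter_upwards [Icc_mem_nhds hm.1 hm.2] with s hs using hV s hs
  · have h0 : chartField o γ (fun _ => 0 : VField E γ) t = 0 := map_zero (dchart o (γ t))
    rw [h0, hV t htI, chartMetric_eq, chartMetric_eq, neg_apply, map_neg, neg_apply,
      chartForm_christoffelSecond g hmem]
    simp

/-- Parallel transport along an absolutely continuous curve. -/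
theorem exists_parallel (hab : a ≤ b) (hγ : IsACCurve E γ a b)
    (v : TangentSpace 𝓘(ℝ, E) (γ a)) :
    ∃ V : VField E γ, V a = v ∧ IsParallel g γ a b V := by
  refine interval_induction (P := fun c d => ∀ v : TangentSpace 𝓘(ℝ, E) (γ c),
    ∃ V : VField E γ, V c = v ∧ IsParallel g γ c d V) hab (fun t ht => ?_) ?_ v
  · obtain ⟨U, hU, htU, hsub⟩ := hγ.exists_chart ht
    refine ⟨U, hU, htU, fun c d hac hcd hdb hs v => ?_⟩
    exact exists_parallel_of_chart (hγ.mono hac hdb)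
      ((hsub c d hac hcd hdb hs).sub le_rfl hcd le_rfl) v
  · intro c m d _ hcm hmd _ h1 h2 v
    obtain ⟨V, hV, hp⟩ := h1 v
    obtain ⟨W, hW, hq⟩ := h2 (V m)
    let Z : VField E γ := fun t => if t ≤ m then V t else W t
    have hZ1 : ∀ t ≤ m, Z t = V t := fun t ht => if_pos ht
    have hZ2 : ∀ t, m ≤ t → Z t = W t := fun t ht => by
      rcases ht.eq_or_lt with rfl | h
      · rw [hZ1 _ le_rfl, hW]
      · exact if_neg h.not_ge
    refine ⟨Z, by rw [hZ1 c hcm, hV], IsCovDeriv.glue (m := m) ?_ ?_⟩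
    · exact IsCovDeriv.congr hp (fun t ht => hZ1 t ht.2) fun _ _ => rfl
    · exact IsCovDeriv.congr hq (fun t ht => hZ2 t ht.1) fun _ _ => rfl

end ParallelTransport

/-! ### Orthonormal families for a positive definite form. -/

section BilinearForm

variable {F : Type*} [AddCommGroup F] [Module ℝ F]

/-- Cauchy–Schwarz, from positivity on the component of `u` orthogonal to `e`. It dominates the
frame coefficients of `μ` by `|μ|_g`. -/
lemma abs_le_sqrt_of_unit (B : F →ₗ[ℝ] F →ₗ[ℝ] ℝ) (hs : ∀ u v, B u v = B v u)
    (hp : ∀ v, v ≠ 0 → 0 < B v v) {e : F} (he : B e e = 1) (u : F) :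
    |B u e| ≤ √(B u u) := by
  refine Real.abs_le_sqrt ?_
  have h : 0 ≤ B (u - B u e • e) (u - B u e • e) := by
    rcases eq_or_ne (u - B u e • e) 0 with h | h
    · simp [h]
    · exact (hp _ h).le
  simp only [map_sub, map_smul, LinearMap.sub_apply, LinearMap.smul_apply, smul_eq_mul, he,
    hs e u] at h
  nlinarith

variable [FiniteDimensional ℝ F]

lemma exists_orthonormal_family (B : F →ₗ[ℝ] F →ₗ[ℝ] ℝ) (hs : ∀ u v, B u v = B v u)
    (hp : ∀ v, v ≠ 0 → 0 < B v v) :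
    ∃ e : Fin (Module.finrank ℝ F) → F, ∀ i j, B (e i) (e j) = if i = j then 1 else 0 := by
  -- `B` is made the inner product of `F` inside this proof only, to borrow a standard orthonormal
  -- basis.
  let core : InnerProductSpace.Core ℝ F :=
    { inner := fun u v => B u v
      conj_inner_symm := fun u v => by simpa using hs v u
      re_inner_nonneg := fun v => by
        rcases eq_or_ne v 0 with rfl | hv
        · simp
        · simpa using (hp v hv).le
      add_left := fun u v w => by simp
      smul_left := fun u v r => by simp
      definite := fun v hv => by
        by_contra h
        exact (hp v h).ne' hv }
  let _ : NormedAddCommGroup F := core.toNormedAddCommGroup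
  let _ : InnerProductSpace ℝ F := InnerProductSpace.ofCore core.toCore
  let e := stdOrthonormalBasis ℝ F
  exact ⟨e, fun i j => orthonormal_iff_ite.1 e.orthonormal i j⟩

lemma eq_sum_of_orthonormal (B : F →ₗ[ℝ] F →ₗ[ℝ] ℝ) {e : Fin (Module.finrank ℝ F) → F}
    (he : ∀ i j, B (e i) (e j) = if i = j then 1 else 0) (v : F) :
    v = ∑ i, B v (e i) • e i := by
  have hcoef : ∀ (c : Fin (Module.finrank ℝ F) → ℝ) j, B (∑ i, c i • e i) (e j) = c j := by
    intro c j
    simp [he]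
  have hli : LinearIndependent ℝ e := by
    rw [Fintype.linearIndependent_iff]
    intro c hc i
    rw [← hcoef c i, hc, map_zero, LinearMap.zero_apply]
  have hspan : v ∈ Submodule.span ℝ (range e) := by
    rw [hli.span_eq_top_of_card_eq_finrank' (by simp)]
    trivial
  obtain ⟨c, rfl⟩ := (Submodule.mem_span_range_iff_exists_fun ℝ).1 hspan
  simp only [hcoef]

end BilinearForm

/-! ### Leibniz rule, isometry and parallel orthonormal frames. -/

variable {E : Type*} [NormedAddCommGroup E] [NormedSpace ℝ E]
  {M : Type*} [TopologicalSpace M] [ChartedSpace E M] {γ : ℝ → M} {a b : ℝ}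

lemma chartField_sum {p : M} {ι : Type*} [Fintype ι] (c : ι → ℝ → ℝ) (e : ι → VField E γ) (t : ℝ) :
    chartField p γ (fun t => ∑ i, c i t • e i t) t = ∑ i, c i t • chartField p γ (e i) t := by
  change dchart (E := E) p (γ t) (∑ i, c i t • (show E from e i t)) = _
  rw [map_sum]
  exact Finset.sum_congr rfl fun i _ => (dchart p (γ t)).map_smul (c i t) (show E from e i t)

variable [FiniteDimensional ℝ E] [IsManifold 𝓘(ℝ, E) ∞ M] {g : SmoothMetric E M}

/-- The Leibniz rule for combinations of parallel fields. -/
lemma isCovDeriv_sum (hγ : IsACCurve E γ a b) {ι : Type*} [Fintype ι] {e : ι → VField E γ}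
    (he : ∀ i, IsParallel g γ a b (e i)) {c c' : ι → ℝ → ℝ}
    (hc : ∀ i t, HasDerivAt (c i) (c' i t) t) (hc' : ∀ i, Continuous (c' i)) :
    IsCovDeriv g γ a b (fun t => ∑ i, c i t • e i t) (fun t => ∑ i, c' i t • e i t) := by
  have hac : ∀ i s t, AbsolutelyContinuousOnInterval (c i) s t := fun i s t => by
    refine (ContDiff.contDiffOn ?_).absolutelyContinuousOnInterval
    rw [contDiff_one_iff_deriv]
    refine ⟨fun t => (hc i t).differentiableAt, ?_⟩
    rw [show deriv (c i) = c' i from funext fun t => (hc i t).deriv]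
    exact hc' i
  refine ⟨fun p s t hI => ?_, fun p s t hI => ?_⟩
  · have : ∀ S : Finset ι, AbsolutelyContinuousOnInterval
        (fun r => ∑ i ∈ S, c i r • chartField p γ (e i) r) s t := by
      intro S
      classical
      induction S using Finset.induction_on with
      | empty =>
        simp only [Finset.sum_empty]
        exact contDiffOn_const.absolutelyContinuousOnInterval
      | insert i S hi ih =>
        simp only [Finset.sum_insert hi]
        exact ((hac i s t).fun_smul ((he i).1 p s t hI)).fun_add ih
    exact (this Finset.univ).congr fun r _ => chartField_sum c e r
  · have hx := hγ.2 p s t hI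
    have h1 := ae_all_iff.2 fun i => (he i).2 p s t hI
    filter_upwards [h1, ae_restrict_of_ae hx.ae_hasDerivAt_deriv,
      ae_restrict_mem measurableSet_Icc] with r hr hxr hm
    have hx' := hxr (by rwa [uIcc_of_le hI.2.1])
    have hmem := chartCurve_mem_target (hI.2.2.2 r hm)
    choose x' v' hx'' hv' H using hr
    -- Each `e i` comes with its own velocity of the curve; uniqueness of derivatives identifies
    -- them.
    have hxx : ∀ i, x' i = deriv (chartCurve p γ) r := fun i => (hx'' i).unique hx'
    refine ⟨deriv (chartCurve p γ) r,
      ∑ i, (c i r • v' i + c' i r • chartField p γ (e i) r), hx', ?_, fun w => ?_⟩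
    · have h2 := HasDerivAt.fun_sum (u := Finset.univ) fun i _ => (hc i r).smul (hv' i)
      exact h2.congr_of_eventuallyEq (Eventually.of_forall fun r => chartField_sum c e r)
    · have h3 : ∀ i, chartForm g p (chartCurve p γ r) (v' i) w
          + christoffelForm g p (chartCurve p γ r) (deriv (chartCurve p γ) r)
            (chartField p γ (e i) r) w = 0 := fun i => by
        have h0 : chartField p γ (fun _ => 0 : VField E γ) r = 0 := map_zero (dchart p (γ r))
        have := H i w
        rw [h0, hxx i, chartMetric_eq, chartMetric_eq, map_zero, zero_apply] at this
        rw [christoffelForm_apply g hmem, ← this]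
      rw [chartField_sum, chartField_sum, chartMetric_eq, chartMetric_eq,
        ← christoffelForm_apply g hmem]
      simp only [map_sum, map_add, map_smul, sum_apply, add_apply, smul_apply, smul_eq_mul]
      rw [← Finset.sum_add_distrib]
      refine Finset.sum_congr rfl fun i _ => ?_
      linear_combination -(c i r) * h3 i

/-- Parallel transport is isometric. -/
lemma IsParallel.metricForm_eq (hγ : IsACCurve E γ a b) {V W : VField E γ}
    (hV : IsParallel g γ a b V) (hW : IsParallel g γ a b W) {t : ℝ} (ht : t ∈ Icc a b) :
    metricForm g (γ a) (V a) (W a) = metricForm g (γ t) (V t) (W t) := by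
  have hγt := hγ.mono le_rfl ht.2
  refine interval_induction (P := fun c d => metricForm g (γ c) (V c) (W c)
    = metricForm g (γ d) (V d) (W d)) ht.1 (fun s hs => ?_) ?_
  · obtain ⟨U, hU, hsU, hsub⟩ := hγt.exists_chart hs
    refine ⟨U, hU, hsU, fun c d hac hcd hdt hcdU => ?_⟩
    have hI := (hsub c d hac hcd hdt hcdU).mono (a := a) (b := b) le_rfl ht.2
    set o := γ s
    have hx := hγ.2 o c d hI
    have hv := hV.1 o c d hI
    have hw := hW.1 o c d hI
    have hmem : ∀ r ∈ uIcc c d, chartCurve o γ r ∈ (extChartAt 𝓘(ℝ, E) o).target :=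
      fun r hr => chartCurve_mem_target (hI.2.2.2 r (by rwa [uIcc_of_le hcd] at hr))
    have hφ : ContDiffOn ℝ 1 (fun z : E × E × E => chartForm g o z.1 z.2.1 z.2.2)
        ((extChartAt 𝓘(ℝ, E) o).target ×ˢ univ) := by
      rintro ⟨y, u, v⟩ ⟨hy, -⟩
      refine ContDiffAt.contDiffWithinAt ?_
      have h1 : ContDiffAt ℝ 1 (fun z : E × E × E => chartForm g o z.1) (y, u, v) :=
        ((contDiffAt_chartForm g hy).of_le (by simp)).comp (y, u, v) contDiffAt_fst
      exact (h1.clm_apply contDiff_snd.fst.contDiffAt).clm_apply contDiff_snd.snd.contDiffAt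
    have hF := AbsolutelyContinuousOnInterval.contDiffOn_comp
      ((isOpen_target o).prod isOpen_univ) hφ (hx.prodMk (hv.prodMk hw))
      fun r hr => ⟨hmem r hr, mem_univ _⟩
    -- Metric compatibility: `∂_{x'} G(V, W) = [x' V, W] + [x' W, V]`, and parallelism replaces the
    -- two brackets by `-G(V', W)` and `-G(W', V)`.
    have hzero : ∀ᵐ r, r ∈ uIcc c d → HasDerivAt (fun r => chartForm g o (chartCurve o γ r)
        (chartField o γ V r) (chartField o γ W r)) 0 r := by
      have h1 := (ae_restrict_iff' measurableSet_Icc).1 (hV.2 o c d hI)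
      have h2 := (ae_restrict_iff' measurableSet_Icc).1 (hW.2 o c d hI)
      filter_upwards [h1, h2] with r h1 h2 hr
      have hy := hmem r hr
      rw [uIcc_of_le hcd] at hr
      obtain ⟨x', v', hx', hv', HV⟩ := h1 hr
      obtain ⟨x'', w', hx'', hw', HW⟩ := h2 hr
      obtain rfl := hx'.unique hx''
      have h0 : chartField o γ (fun _ => 0 : VField E γ) r = 0 := map_zero (dchart o (γ r))
      have hv1 := HV (chartField o γ W r)
      have hw1 := HW (chartField o γ V r)
      rw [h0, chartMetric_eq, chartMetric_eq, map_zero, zero_apply,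
        christoffelFirst_eq g hy] at hv1 hw1
      have hG := HasFDerivAt.comp_hasDerivAt (l := chartForm g o) r
        (differentiableAt_chartForm g hy).hasFDerivAt hx'
      refine ((hG.clm_apply hv').clm_apply hw').congr_deriv ?_
      rw [chartForm_symm g o _ w'] at hw1
      rw [fderiv_chartForm_symm g hy (chartField o γ W r) (chartField o γ V r)] at hw1
      simp only [add_apply, Function.comp_apply]
      linarith
    obtain ⟨C, hC⟩ := hF.const_of_ae_hasDerivAt_zero hzero
    have hpt : ∀ r ∈ Icc c d, metricForm g (γ r) (V r) (W r) = C := fun r hr => by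
      rw [← hC r (by rwa [uIcc_of_le hcd])]
      exact (chartForm_dchart g (hI.2.2.2 r hr) (V r) (W r)).symm
    rw [hpt c (left_mem_Icc.2 hcd), hpt d (right_mem_Icc.2 hcd)]
  · intro c m d _ _ _ _ h1 h2
    exact h1.trans h2

/-- In a chart this is a continuous family of bilinear forms evaluated at measurable arguments;
finitely many charts suffice. -/
lemma aestronglyMeasurable_metricForm (hab : a ≤ b) (hγ : IsACCurve E γ a b) {U V : VField E γ}
    (hU : IsMeasurableField γ a b U) (hV : IsACField γ a b V) :
    AEStronglyMeasurable (fun t => metricForm g (γ t) (U t) (V t))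
      (volume.restrict (Icc a b)) := by
  refine interval_induction (P := fun c d => AEStronglyMeasurable
    (fun t => metricForm g (γ t) (U t) (V t)) (volume.restrict (Icc c d))) hab (fun s hs => ?_) ?_
  · obtain ⟨S, hS, hsS, hsub⟩ := hγ.exists_chart hs
    refine ⟨S, hS, hsS, fun c d hac hcd hdt hcdS => ?_⟩
    have hI := hsub c d hac hcd hdt hcdS
    set o := γ s
    have hx := (hγ.2 o c d hI).continuousOn
    have hv := (hV o c d hI).continuousOn
    rw [uIcc_of_le hcd] at hx hv
    have hG : ContinuousOn (fun r => chartForm g o (chartCurve o γ r)) (Icc c d) :=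
      (contDiffOn_chartForm g o).continuousOn.comp hx fun r hr =>
        chartCurve_mem_target (hI.2.2.2 r hr)
    have h1 := (ContinuousLinearMap.id ℝ (E →L[ℝ] E →L[ℝ] ℝ)).aestronglyMeasurable_comp₂
      (hG.aestronglyMeasurable (μ := volume) measurableSet_Icc) (hU o c d hI)
    have h2 := (ContinuousLinearMap.id ℝ (E →L[ℝ] ℝ)).aestronglyMeasurable_comp₂ h1
      (hv.aestronglyMeasurable (μ := volume) measurableSet_Icc)
    refine h2.congr ?_
    filter_upwards [ae_restrict_mem measurableSet_Icc] with r hr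
    exact chartForm_dchart g (hI.2.2.2 r hr) (U r) (V r)
  · intro c m d _ hcm hmd _ h1 h2
    rw [← Icc_union_Icc_eq_Icc hcm hmd, aestronglyMeasurable_union_iff]
    exact ⟨h1, h2⟩

/-- Parallel orthonormal frames exist along absolutely continuous curves. -/
theorem exists_parallel_orthonormal_frame (g : SmoothMetric E M) (hab : a ≤ b)
    (hγ : IsACCurve E γ a b) :
    ∃ e : Fin (Module.finrank ℝ E) → VField E γ, (∀ i, IsParallel g γ a b (e i)) ∧
      ∀ t ∈ Icc a b, ∀ i j, metricForm g (γ t) (e i t) (e j t) = if i = j then 1 else 0 := by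
  obtain ⟨f, hf⟩ := exists_orthonormal_family (metricForm g (γ a)).toLinearMap₁₂
    (metricForm_symm g (γ a)) fun v hv => metricForm_pos g (γ a) hv
  choose e he hp using fun i => exists_parallel (g := g) hab hγ (f i)
  refine ⟨e, hp, fun t ht i j => ?_⟩
  rw [← IsParallel.metricForm_eq hγ (hp i) (hp j) ht, he, he]
  exact hf i j

/-! ### Scalar multiples of a parallel field as test fields. -/

section FrameFields

variable {E : Type*} [NormedAddCommGroup E] [NormedSpace ℝ E]
  {M : Type*} [TopologicalSpace M] [ChartedSpace E M]
  {γ : ℝ → M} {a b : ℝ} {e : VField E γ}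

lemma hasCompactSupportIn_smul (hab : a < b) (φ : testFunctions a b) :
    HasCompactSupportIn γ a b (fun t => φ.1 t • e t) := by
  obtain ⟨φ, -, hφ, hsub⟩ := φ
  have hzero : ∀ t, t ∉ tsupport φ → φ t • e t = 0 := fun t ht => by
    rw [image_eq_zero_of_notMem_tsupport ht, zero_smul]
  rcases (tsupport φ).eq_empty_or_nonempty with h | h
  · obtain ⟨c, hc⟩ := exists_between hab
    exact ⟨c, c, hc.1, hc.2, fun t _ _ => hzero t (by simp [h])⟩
  · obtain ⟨c, hc⟩ := hφ.isCompact.exists_isLeast h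
    obtain ⟨d, hd⟩ := hφ.isCompact.exists_isGreatest h
    exact ⟨c, d, (hsub hc.1).1, (hsub hd.1).2, fun t _ ht => hzero t fun h' =>
      ht ⟨hc.2 h', hd.2 h'⟩⟩

variable [FiniteDimensional ℝ E] [IsManifold 𝓘(ℝ, E) ∞ M] {g : SmoothMetric E M}

lemma isCovDeriv_smul (hγ : IsACCurve E γ a b) (he : IsParallel g γ a b e) {c c' : ℝ → ℝ}
    (hc : ∀ t, HasDerivAt c (c' t) t) (hc' : Continuous c') :
    IsCovDeriv g γ a b (fun t => c t • e t) (fun t => c' t • e t) := by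
  simpa using isCovDeriv_sum (ι := Unit) hγ (fun _ => he) (c := fun _ => c) (c' := fun _ => c')
    (fun _ => hc) fun _ => hc'

lemma isSmoothField_smul (hγ : IsACCurve E γ a b) (he : IsParallel g γ a b e) {φ : ℝ → ℝ}
    (hφ : ContDiff ℝ ∞ φ) : IsSmoothField g γ a b (fun t => φ t • e t) := by
  -- As `e` is parallel, each covariant derivative falls on the scalar factor only.
  refine ⟨fun j t => iteratedDeriv j φ t • e t, by simp, fun j => ?_⟩
  refine isCovDeriv_smul hγ he (fun t => ?_) (hφ.continuous_iteratedDeriv (j + 1) (mod_cast le_top))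
  rw [iteratedDeriv_succ]
  exact ((hφ.differentiable_iteratedDeriv j (mod_cast ENat.natCast_lt_top j)) t).hasDerivAt

/-- The primitive of `φ` from `a`, times `e`, is the required field `ν`. This turns covariant
moments into scalar moments. -/
lemma hasCovIntegral_smul (hγ : IsACCurve E γ a b) (he : IsParallel g γ a b e) {φ : ℝ → ℝ}
    (hφ : Continuous φ) :
    HasCovIntegral g γ a b (fun t => φ t • e t) ((∫ t in a..b, φ t) • e b) :=
  ⟨fun t => (∫ s in a..t, φ s) • e t,
    isCovDeriv_smul hγ he (fun t => hφ.integral_hasStrictDerivAt a t |>.hasDerivAt) hφ,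
    by simp, rfl⟩

end FrameFields

end AlongCurve

end

/-! ### Reduction to the scalar lemma in the frame. -/

theorem mainTheorem8
    {E : Type*} [NormedAddCommGroup E] [NormedSpace ℝ E] [FiniteDimensional ℝ E]
    {M : Type*} [TopologicalSpace M] [ChartedSpace E M] [IsManifold 𝓘(ℝ, E) ∞ M]
    (g : AlongCurve.SmoothMetric E M) (k : ℕ) (a b : ℝ) (hab : a < b)
    (γ : ℝ → M) (hγ : AlongCurve.IsACCurve E γ a b)
    (μ : AlongCurve.VField E γ) (hμ : AlongCurve.IsL1Field g γ a b μ)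
    (horth : ∀ η : AlongCurve.VField E γ,
      AlongCurve.IsSmoothField g γ a b η → AlongCurve.HasCompactSupportIn γ a b η →
      (∀ ℓ : ℕ, ℓ ≤ k →
        AlongCurve.HasCovIntegral g γ a b (fun t => t ^ ℓ • η t) 0) →
      ∫ t in a..b, g.inner (γ t) (μ t) (η t) = 0) :
    ∃ ζ : ℕ → AlongCurve.VField E γ,
      (∀ ℓ : ℕ, ℓ ≤ k → AlongCurve.IsParallel g γ a b (ζ ℓ)) ∧
      ∀ᵐ t ∂(volume.restrict (Ioo a b)),
        μ t = ∑ ℓ ∈ Finset.range (k + 1), t ^ ℓ • ζ ℓ t := by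
  obtain ⟨e, hpar, hon⟩ := AlongCurve.exists_parallel_orthonormal_frame g hab.le hγ
  have hint : ∀ i, IntervalIntegrable
      (fun t => AlongCurve.metricForm g (γ t) (μ t) (e i t)) volume a b := by
    intro i
    rw [intervalIntegrable_iff_integrableOn_Icc_of_le hab.le]
    refine Integrable.mono' hμ.2
      (AlongCurve.aestronglyMeasurable_metricForm hab.le hγ hμ.1 (hpar i).1) ?_
    filter_upwards [ae_restrict_mem measurableSet_Icc] with t ht
    exact AlongCurve.abs_le_sqrt_of_unit (AlongCurve.metricForm g (γ t)).toLinearMap₁₂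
      (AlongCurve.metricForm_symm g (γ t)) (fun v hv => AlongCurve.metricForm_pos g (γ t) hv)
      ((hon t ht i i).trans (if_pos rfl)) (μ t)
  have hpoly := fun i => AlongCurve.exists_polynomial_of_orthogonal hab k (hint i) fun φ hφ => by
    have h := horth (fun t => φ.1 t • e i t) (AlongCurve.isSmoothField_smul hγ (hpar i) φ.2.1)
      (AlongCurve.hasCompactSupportIn_smul hab φ) fun l hl => by
        have := AlongCurve.hasCovIntegral_smul hγ (hpar i) (φ := fun t => t ^ l * φ.1 t)
          ((continuous_pow l).mul φ.2.1.continuous)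
        simpa only [hφ l hl, zero_smul, mul_smul] using this
    rw [← h]
    congr 1; ext t
    rw [map_smul, smul_eq_mul, mul_comm]
    rfl
  choose c hc using hpoly
  refine ⟨fun l t => ∑ i, c i l • e i t, fun l _ => ?_, ?_⟩
  -- Constant coefficients: the Leibniz rule gives zero covariant derivative.
  · have := AlongCurve.isCovDeriv_sum hγ hpar (c := fun i _ => c i l) (c' := fun _ _ => 0)
      (fun i t => hasDerivAt_const t _) fun _ => continuous_const
    simp only [zero_smul, Finset.sum_const_zero] at this
    exact this
  · filter_upwards [ae_restrict_of_ae (ae_all_iff.2 hc), ae_restrict_mem measurableSet_Ioo]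
      with t ht hm
    -- Expand `μ t` in the frame, insert the polynomial coefficients, and exchange the sums over `i`
    -- and `l`.
    have h1 := AlongCurve.eq_sum_of_orthonormal (AlongCurve.metricForm g (γ t)).toLinearMap₁₂
      (hon t (Ioo_subset_Icc_self hm)) (μ t)
    refine h1.trans ?_
    simp_rw [Finset.smul_sum]
    rw [Finset.sum_comm]
    refine Finset.sum_congr rfl fun i _ => ?_
    refine (congrArg (· • e i t) (ht i hm)).trans ?_
    simp only [Finset.sum_smul, mul_smul]
    exact Finset.sum_congr rfl fun l _ => smul_comm _ _ _
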